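/- Let $n\ge 2$ and $N=n(n-1)/2$. **The random vectors.** *Oriented swap process.* At time $0$, particle $j$ is in position $j$, $1\le j\le n$. Each pair of adjacent positions $k,k+1$ has a Poisson clock of rate $1$, all independent; whenever it rings, the particles in positions $k,k+1$ swap if the label in position $k$ is smaller than the one in position $k+1$, and otherwise nothing happens. Let $U_n(k)$ be the last time at which a swap occurs between positions $k$ and $k+1$, and $U_n=(U_n(1),\dots,U_n(n-1))$. *Randomly growing diagram.* Let $\delta_n=(n-1,n-2,\dots,1)$ be the staircase shape, with boxes $(i,j)$ (row, column), $i,j\ge1$, $i+j\le n$. Start from the empty Young diagram. Each box of $\delta_n$ has a Poisson clock of rate $1$, all independent; whenever it rings, the box is added to the current diagram if the result is a Young diagram, and otherwise nothing happens. Let $V_n(k)$ be the time at which the box $(n-k,k)$ is added, and $V_n=(V_n(1),\dots,V_n(n-1))$. **Generating factors.** For a vector $v=(v(1),\dots,v(n-1))$ of distinct positive integers, let $\mathrm{ord}(v)\in S_{n-1}$ be the permutation with $\mathrm{ord}(v)(j)<\mathrm{ord}(v)(k)\iff v(j)<v(k)$, let $\bar v(1)<\dots<\bar v(n-1)$ be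 its increasing rearrangement, and let $\bar v(0)=0$. For $d=(d(0),\dots,d(N-1))$ and $\max v\le N$ put $$\Phi_{v,d}(x_1,\dots,x_{n-1})=\prod_{k=1}^{n-1}\ \prod_{\bar v(k-1)\le j<\bar v(k)}\frac1{x_k+d(j)}.$$ *Tableaux.* Let $\mathrm{SYT}(\delta_n)$ be the set of standard Young tableaux $t=(t_{i,j})$ of shape $\delta_n$. Let $\mathrm{cor}_t=(t_{n-1,1},t_{n-2,2},\dots,t_{1,n-1})$, $\sigma_t=\mathrm{ord}(\mathrm{cor}_t)$, and let $\deg_t(k)$, $0\le k\le N-1$, be the number of boxes of $\delta_n$ outside $\lambda^{(k)}=\{(i,j):t_{i,j}\le k\}$ whose addition to $\lambda^{(k)}$ gives a Young diagram. Put $f_t=\Phi_{\mathrm{cor}_t,\deg_t}$. *Sorting networks.* Let $\mathrm{SN}_n$ be the set of sequences $s=(s_1,\dots,s_N)\in\{1,\dots,n-1\}^N$ such that swapping successively the entries in positions $s_1,s_1+1$, then $s_2,s_2+1$, and so on up to $s_N,s_N+1$, takes the arrangement $(1,2,\dots,n)$ to $(n,\dots,2,1)$. Let $\mathrm{last}_s(k)=\max\{j:s_j=k\}$,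 $\pi_s=\mathrm{ord}(\mathrm{last}_s)$, and let $\deg_s(k)$, $0\le k\le N-1$, be the number of $j\in\{1,\dots,n-1\}$ with $\nu^{(k)}(j)<\nu^{(k)}(j+1)$, where $\nu^{(k)}$ is the arrangement after the first $k$ swaps. Put $g_s=\Phi_{\mathrm{last}_s,\deg_s}$. **Statement.** For each $n\ge2$, the random vectors $U_n$ and $V_n$ are equal in distribution if and only if $$\sum_{t\in \mathrm{SYT}(\delta_n)} f_t(x_1,\dots,x_{n-1})\,\sigma_t=\sum_{s\in \mathrm{SN}_n} g_s(x_1,\dots,x_{n-1})\,\pi_s$$ in the free vector space with basis $S_{n-1}$ over the field $\mathbb C(x_1,\dots,x_{n-1})$. -/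

import Mathlib

open MeasureTheory ProbabilityTheory

noncomputable section

namespace OrientedSwap

/-! ## Independent Poisson clocks and the dynamics they drive -/

section Clocks

variable {K X : Type*}

/-- `E k m` is the waiting time of clock `k` between its `m`-th and its `(m+1)`-st ring (the `0`-th
ring being time `0`). The clocks are independent Poisson clocks of rate one iff all the waiting
times are independent and exponential of rate one. -/
structure IsPoissonClocks {Ω : Type*} [MeasurableSpace Ω] (μ : Measure Ω)
    (E : K → ℕ → Ω → ℝ) : Prop where
  measurable : ∀ k m, Measurable (E k m)
  law : ∀ k m, μ.map (E k m) = expMeasure 1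
  indep : iIndepFun (fun p : K × ℕ => E p.1 p.2) μ

/-- The time of the `(m+1)`-st ring of clock `k`, for given waiting times `e`. -/
def ringTime (e : K → ℕ → ℝ) (k : K) (m : ℕ) : ℝ := ∑ i ∈ Finset.range (m + 1), e k i

variable [Finite K] [Nonempty K]

/-- The clock that rings next, if each clock `k` has already rung `c k` times: the one whose next
ring is the earliest (ties, which almost surely do not occur, are broken arbitrarily). -/
def nextClock (e : K → ℕ → ℝ) (c : K → ℕ) : K :=
  Classical.choose (Finite.exists_min fun k => ringTime e k (c k))

open Classical in
/-- How often each clock has rung, among the first `i` rings of all the clocks together. -/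
def ringCount (e : K → ℕ → ℝ) : ℕ → K → ℕ
  | 0 => fun _ => 0
  | i + 1 =>
    let k := nextClock e (ringCount e i)
    Function.update (ringCount e i) k (ringCount e i k + 1)

/-- The clock that produces the ring number `i` (counted from `0`) of all the clocks together. -/
def clockAt (e : K → ℕ → ℝ) (i : ℕ) : K := nextClock e (ringCount e i)

/-- The time of the ring number `i` (counted from `0`) of all the clocks together. -/
def timeAt (e : K → ℕ → ℝ) (i : ℕ) : ℝ := ringTime e (clockAt e i) (ringCount e i (clockAt e i))

/-- The state just before the ring number `i`, if the dynamics starts at `x₀` and every ring of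
a clock `k` turns the current state `x` into `act k x`. -/
def stateBefore (act : K → X → X) (x₀ : X) (e : K → ℕ → ℝ) : ℕ → X
  | 0 => x₀
  | i + 1 => act (clockAt e i) (stateBefore act x₀ e i)

/-- The times at which clock `k` rings and its attempt succeeds, i.e. changes the state. -/
def successTimes (act : K → X → X) (x₀ : X) (e : K → ℕ → ℝ) (k : K) : Set ℝ :=
  {t | ∃ i, clockAt e i = k ∧
    act k (stateBefore act x₀ e i) ≠ stateBefore act x₀ e i ∧ timeAt e i = t}

end Clocks

/-! ## The oriented swap process

Positions and labels are numbered from `0`; the index `k : Fin (n - 1)` stands for the pair of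
adjacent positions `k`, `k + 1`. -/

section OSP

variable {n : ℕ}

/-- The left one of the two adjacent positions with index `k`. -/
def leftPos (k : Fin (n - 1)) : Fin n := ⟨k, by omega⟩

/-- The right one of the two adjacent positions with index `k`. -/
def rightPos (k : Fin (n - 1)) : Fin n := ⟨k + 1, by omega⟩

/-- The adjacent transposition of the positions with index `k`. -/
def adjSwap (k : Fin (n - 1)) : Equiv.Perm (Fin n) := Equiv.swap (leftPos k) (rightPos k)

/-- An attempted swap. The arrangement `ν` maps each position to the label of the particle there;
the particles in the positions with index `k` swap iff this creates an inversion. -/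
def swapAttempt (k : Fin (n - 1)) (ν : Equiv.Perm (Fin n)) : Equiv.Perm (Fin n) :=
  if ν (leftPos k) < ν (rightPos k) then ν * adjSwap k else ν

/-- The vector `U_n` of last swap times of the oriented swap process driven by clocks with waiting
times `e`. -/
def lastSwapTimes (hn : 2 ≤ n) (e : Fin (n - 1) → ℕ → ℝ) : Fin (n - 1) → ℝ :=
  haveI : Nonempty (Fin (n - 1)) := ⟨⟨0, by omega⟩⟩
  fun k => sSup (successTimes swapAttempt 1 e k)

end OSP

/-! ## The randomly growing staircase diagram

Rows and columns are numbered from `0`. -/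

/-- The staircase diagram `δ_n = (n-1, n-2, …, 1)`. -/
def staircase (n : ℕ) : YoungDiagram where
  cells := (Finset.range n ×ˢ Finset.range n).filter fun c => c.1 + c.2 + 2 ≤ n
  isLowerSet := by
    rintro ⟨a, b⟩ ⟨c, d⟩ h h'
    have h₁ : c ≤ a := h.1
    have h₂ : d ≤ b := h.2
    simp only [Finset.coe_filter, Finset.mem_product, Finset.mem_range, Set.mem_ofPred_eq] at h' ⊢
    omega

/-- The boxes of `δ_n`, as pairs (row, column). -/
abbrev Box (n : ℕ) : Type := {c : ℕ × ℕ // c ∈ (staircase n).cells}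

section Growth

variable {n : ℕ}

/-- The corner box of `δ_n` in column `k`, i.e. the box `(n - k, k)` if rows, columns and `k` are
numbered from `1`. -/
def cornerBox (k : Fin (n - 1)) : Box n :=
  ⟨(n - 2 - k, k), by
    have := k.isLt
    simp only [staircase, Finset.mem_filter, Finset.mem_product, Finset.mem_range]
    omega⟩

open Classical in
/-- An attempted addition of the box `b`: it is added iff the result is a Young diagram. -/
def addAttempt (b : Box n) (lam : YoungDiagram) : YoungDiagram :=
  if h : IsLowerSet ((insert b.1 lam.cells : Finset (ℕ × ℕ)) : Set (ℕ × ℕ)) then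
    ⟨insert b.1 lam.cells, h⟩ else lam

/-- The vector `V_n` of the times at which the corner boxes are added, for the randomly growing
diagram driven by clocks with waiting times `e`. (Almost surely, each box is added exactly once:
the supremum is that of a one-point set.) -/
def cornerTimes (hn : 2 ≤ n) (e : Box n → ℕ → ℝ) : Fin (n - 1) → ℝ :=
  haveI : Nonempty (Box n) := ⟨cornerBox ⟨0, by omega⟩⟩
  fun k => sSup (successTimes addAttempt ⊥ e (cornerBox k))

end Growth

/-! ## Orderings and generating factors -/

section Ordering

variable {m : ℕ}

/-- The permutation that encodes the ordering of the entries of a vector with distinct entries. -/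
def orderPerm (v : Fin m → ℕ) : Equiv.Perm (Fin m) := (Tuple.sort v)⁻¹

theorem orderPerm_lt_iff (v : Fin m → ℕ) (hv : Function.Injective v) (j k : Fin m) :
    orderPerm v j < orderPerm v k ↔ v j < v k := by
  have hs : StrictMono (v ∘ Tuple.sort v) :=
    (Tuple.monotone_sort v).strictMono_of_injective (hv.comp (Tuple.sort v).injective)
  have := hs.lt_iff_lt (a := orderPerm v j) (b := orderPerm v k)
  simpa [orderPerm] using this.symm

/-- The increasing rearrangement of `v`, numbered from `1`, with the convention that the entry
number `0` is `0`. -/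
def rearranged (v : Fin m → ℕ) : ℕ → ℕ
  | 0 => 0
  | k + 1 => if h : k < m then v ((orderPerm v)⁻¹ ⟨k, h⟩) else 0

/-- The field of rational functions over `ℂ` in `m` variables. -/
abbrev RatFun (m : ℕ) : Type := FractionRing (MvPolynomial (Fin m) ℂ)

/-- The product over the blocks `rearranged v k ≤ j < rearranged v (k+1)`, `k < m`, of the factors
`1 / (x_k + d j)`. -/
def generatingFactor (v : Fin m → ℕ) (d : ℕ → ℕ) : RatFun m :=
  ∏ k : Fin m, ∏ j ∈ Finset.Ico (rearranged v k) (rearranged v (k + 1)),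
    (algebraMap (MvPolynomial (Fin m) ℂ) (RatFun m) (MvPolynomial.X k) + (d j : RatFun m))⁻¹

end Ordering

/-! ## Staircase shape standard Young tableaux -/

/-- The standard Young tableaux of shape `δ_n`: bijective fillings that increase strictly along
rows and columns. The entry of the box `b` is `t b + 1`, in `{1, …, N}`. -/
def StaircaseSYT (n : ℕ) : Type :=
  {t : Box n ≃ Fin (staircase n).card //
    (∀ b c : Box n, b.1.1 = c.1.1 → b.1.2 < c.1.2 → t b < t c) ∧
    (∀ b c : Box n, b.1.2 = c.1.2 → b.1.1 < c.1.1 → t b < t c)}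

instance (n : ℕ) : Finite (StaircaseSYT n) := by unfold StaircaseSYT; infer_instance

instance (n : ℕ) : Fintype (StaircaseSYT n) := Fintype.ofFinite _

namespace StaircaseSYT

variable {n : ℕ} (t : StaircaseSYT n)

/-- The entry of a box, in `{1, …, N}`. -/
def entry (b : Box n) : ℕ := (t.1 b : ℕ) + 1

/-- The vector `cor_t` of corner entries, from bottom-left to top-right. -/
def cor (k : Fin (n - 1)) : ℕ := t.entry (cornerBox k)

/-- The permutation `σ_t`. -/
def sigma : Equiv.Perm (Fin (n - 1)) := orderPerm t.cor

/-- The boxes of the diagram `λ^(k)`, i.e. those with entry at most `k`. -/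
def shape (k : ℕ) : Finset (ℕ × ℕ) := (Finset.univ.filter fun b => t.entry b ≤ k).image Subtype.val

open Classical in
/-- The out-degree `deg_t(k)` of `λ^(k)`. -/
def deg (k : ℕ) : ℕ :=
  ((staircase n).cells.filter fun c => c ∉ t.shape k ∧
    IsLowerSet ((insert c (t.shape k) : Finset (ℕ × ℕ)) : Set (ℕ × ℕ))).card

/-- The generating factor `f_t`. -/
def f : RatFun (n - 1) := generatingFactor t.cor t.deg

end StaircaseSYT

/-! ## Sorting networks -/

/-- The arrangement obtained from the identity by swapping successively the entries in the adjacent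
positions with the first `k` indices of the sequence `s`. -/
def arrangement {n N : ℕ} (s : Fin N → Fin (n - 1)) (k : ℕ) : Equiv.Perm (Fin n) :=
  (((List.ofFn s).take k).map adjSwap).prod

/-- The sorting networks of order `n`: sequences of `N = n (n - 1) / 2` adjacent swaps that take
the identity to the reverse permutation. -/
def SortingNetwork (n : ℕ) : Type :=
  {s : Fin (n * (n - 1) / 2) → Fin (n - 1) //
    arrangement s (n * (n - 1) / 2) = Fin.revPerm}

instance (n : ℕ) : Finite (SortingNetwork n) := by unfold SortingNetwork; infer_instance

instance (n : ℕ) : Fintype (SortingNetwork n) := Fintype.ofFinite _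

namespace SortingNetwork

variable {n : ℕ} (s : SortingNetwork n)

/-- `last_s(k)`, the number (counted from `1`) of the last swap with index `k`. -/
def last (k : Fin (n - 1)) : ℕ := (Finset.univ.filter fun j => s.1 j = k).sup fun j => (j : ℕ) + 1

/-- The permutation `π_s`. -/
def perm : Equiv.Perm (Fin (n - 1)) := orderPerm s.last

/-- `deg_s(k)`, the number of ascents of the arrangement after `k` swaps. -/
def deg (k : ℕ) : ℕ :=
  (Finset.univ.filter fun j : Fin (n - 1) =>
    arrangement s.1 k (leftPos j) < arrangement s.1 k (rightPos j)).card

/-- The generating factor `g_s`. -/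
def g : RatFun (n - 1) := generatingFactor s.last s.deg

end SortingNetwork

end OrientedSwap

end

open OrientedSwap

/-! Both processes are of one kind: finitely many rate-one clocks drive a state that moves only when
a ring succeeds, and the state is absorbed after finitely many successes. Almost surely the list of
successful rings is one of finitely many complete words. These words are the sorting networks for
the swaps (`enumerates_word`) and the standard tableaux for the growing diagram
(`StaircaseSYT.enumerates_word`).

From a state with `d` effective clocks, the event that a given one of them succeeds next contributes
the factor `1 / (d + i y)` to the transform at frequency `y`, and the clocks then start afresh
(`setIntegral_jumpClock`). Iterating along a word, the vector of last times has on the event of that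
word the Fourier transform `∏ j, 1 / (d j + i ∑ ξ)`, where the inner sum runs over the coordinates
whose last ring is still to come at step `j` (`setIntegral_follows`, `wordValue_eq_stepValue`).

The last times are almost surely ordered like the last positions in the word. Restricting to the
cone of vectors ordered like `σ` therefore selects the words with permutation `σ`, and equality in
distribution amounts to equality, for every `σ`, of the transforms summed over these words
(`HasTransform.identDistrib_iff`). This is the source of the coefficients indexed by permutations.

For fixed `σ` the inner sum is constant on each block of steps, and `x_k = i ∑_{σ l ≥ k} ξ_l` is a
bijection from real frequencies to purely imaginary points that turns the generating factor into the
word transform (`factorValue_imagPoint`, `exists_imagPoint`). Degrees are positive before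
absorption, so there are no poles at these points, and rational functions without poles there are
determined by their values there (`HasValues.eq_iff`). `sum_single_eq_iff` combines these facts. -/

noncomputable section

namespace OrientedSwap

/-! ## Restarting the clocks at a ring -/

section Restart

variable {K X : Type*}

open Classical in
/-- The residual waiting times at the first ring, if that is a ring of the clock `k`. -/
def residual (k : K) (e : K × ℕ → ℝ) : K × ℕ → ℝ := fun p =>
  if p.1 = k then e (k, p.2 + 1) else if p.2 = 0 then e p - e (k, 0) else e p

/-- The clock `k` rings strictly before all the others. -/
def RingsFirst (e : K × ℕ → ℝ) (k : K) : Prop := ∀ l, l ≠ k → e (k, 0) < e (l, 0)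

theorem RingsFirst.unique {e : K × ℕ → ℝ} {k l : K} (hk : RingsFirst e k) (hl : RingsFirst e l) :
    k = l := by
  by_contra h
  exact lt_asymm (hk l (Ne.symm h)) (hl k h)

/-- All waiting times are positive, and no two clocks ever ring simultaneously. -/
structure Generic (e : K × ℕ → ℝ) : Prop where
  pos : ∀ p, 0 < e p
  ne : ∀ k l m m', k ≠ l → ringTime (Function.curry e) k m ≠ ringTime (Function.curry e) l m'

-- Passing to the first ring moves the time origin by `e (k, 0)`; clock `k` has also used up one
-- ring, hence the index shift. For `l ≠ k` only the initial waiting time changes, so every partial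
-- sum loses `e (k, 0)` once.
open Classical in
theorem ringTime_residual (k : K) (e : K × ℕ → ℝ) (l : K) (m : ℕ) :
    ringTime (Function.curry (residual k e)) l m =
      ringTime (Function.curry e) l (m + if l = k then 1 else 0) - e (k, 0) := by
  by_cases h : l = k
  · subst h
    simp only [ringTime, Function.curry_apply, residual, if_true]
    rw [Finset.sum_range_succ' _ (m + 1)]
    simp
  · simp only [ringTime, Function.curry_apply, residual, if_neg h, add_zero]
    rw [Finset.sum_range_succ', Finset.sum_range_succ']
    simp [add_sub_assoc]

theorem ringTime_zero (e : K × ℕ → ℝ) (k : K) : ringTime (Function.curry e) k 0 = e (k, 0) := by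
  simp [ringTime]

/-- `hk` keeps the shortened waiting times positive, and a tie after the restart would be a tie
before it. -/
theorem Generic.residual {e : K × ℕ → ℝ} (he : Generic e) {k : K} (hk : RingsFirst e k) :
    Generic (residual k e) := by
  classical
  refine ⟨fun p => ?_, fun a b m m' hab => ?_⟩
  · unfold OrientedSwap.residual
    split_ifs with h h'
    · exact he.pos _
    · have := hk p.1 h
      have hp : p = (p.1, 0) := Prod.ext rfl h'
      rw [hp]
      linarith
    · exact he.pos _
  · rw [ringTime_residual, ringTime_residual]
    intro h
    exact he.ne _ _ _ _ hab (sub_left_injective h)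

variable [Finite K] [Nonempty K]

open Classical in
/-- The clock that rings first (an arbitrary one if there are ties). -/
def firstClock (e : K × ℕ → ℝ) : K :=
  if h : ∃ k, RingsFirst e k then h.choose else Classical.arbitrary K

omit [Finite K] in
theorem RingsFirst.firstClock_eq {e : K × ℕ → ℝ} {k : K} (hk : RingsFirst e k) :
    firstClock e = k := by
  have h : ∃ k, RingsFirst e k := ⟨k, hk⟩
  rw [firstClock, dif_pos h]
  exact h.choose_spec.unique hk

theorem Generic.ringsFirst {e : K × ℕ → ℝ} (he : Generic e) : RingsFirst e (firstClock e) := by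
  obtain ⟨k, hk⟩ := Finite.exists_min fun k => e (k, 0)
  have h : RingsFirst e k := fun l hl => lt_of_le_of_ne (hk l) fun h =>
    he.ne k l 0 0 hl.symm (by simpa [ringTime] using h)
  rwa [h.firstClock_eq]

/-- The waiting times seen from the first ring. -/
def restart (e : K × ℕ → ℝ) : K × ℕ → ℝ := residual (firstClock e) e

/-- The time of the first ring. -/
def firstRing (e : K × ℕ → ℝ) : ℝ := e (firstClock e, 0)

theorem Generic.restart {e : K × ℕ → ℝ} (he : Generic e) : Generic (restart e) :=
  he.residual he.ringsFirst

theorem Generic.iterate_restart {e : K × ℕ → ℝ} (he : Generic e) (i : ℕ) :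
    Generic (OrientedSwap.restart^[i] e) := by
  induction i generalizing e with
  | zero => exact he
  | succ i ih => exact ih he.restart

theorem nextClock_le (e : K → ℕ → ℝ) (c : K → ℕ) (l : K) :
    ringTime e (nextClock e c) (c (nextClock e c)) ≤ ringTime e l (c l) :=
  Classical.choose_spec (Finite.exists_min fun k => ringTime e k (c k)) l

/-- The minimiser in `nextClock` is an arbitrary choice, but without ties it is unique. -/
theorem Generic.nextClock_eq {e : K × ℕ → ℝ} (he : Generic e) {c : K → ℕ} {k : K}
    (hk : ∀ l, ringTime (Function.curry e) k (c k) ≤ ringTime (Function.curry e) l (c l)) :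
    nextClock (Function.curry e) c = k := by
  by_contra h
  exact he.ne _ _ _ _ h (le_antisymm (nextClock_le _ _ _) (hk _))

theorem Generic.clockAt_zero {e : K × ℕ → ℝ} (he : Generic e) :
    clockAt (Function.curry e) 0 = firstClock e := by
  refine he.nextClock_eq fun l => ?_
  simp only [ringCount, ringTime_zero]
  by_cases h : l = firstClock e
  · rw [h]
  · exact (he.ringsFirst l h).le

open Classical in
theorem Generic.nextClock_restart {e : K × ℕ → ℝ} (he : Generic e) (c : K → ℕ) :
    nextClock (Function.curry e) (fun l => c l + if l = firstClock e then 1 else 0) =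
      nextClock (Function.curry (OrientedSwap.restart e)) c := by
  refine he.nextClock_eq fun l => ?_
  have := nextClock_le (Function.curry (OrientedSwap.restart e)) c l
  unfold OrientedSwap.restart at this ⊢
  rw [ringTime_residual, ringTime_residual] at this
  linarith

-- The original run has counted one more ring than the restarted one, and the common time shift does
-- not affect which clock rings next.
open Classical in
theorem Generic.ringCount_succ {e : K × ℕ → ℝ} (he : Generic e) (i : ℕ) :
    ringCount (Function.curry e) (i + 1) = fun l =>
      ringCount (Function.curry (OrientedSwap.restart e)) i l +
        if l = firstClock e then 1 else 0 := by
  induction i with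
  | zero =>
    have := he.clockAt_zero
    rw [clockAt] at this
    funext l
    simp only [ringCount] at this ⊢
    rw [this]
    simp [Function.update_apply]
  | succ i ih =>
    have h := he.nextClock_restart (ringCount (Function.curry (OrientedSwap.restart e)) i)
    rw [ringCount, ih]
    funext l
    simp only [ringCount, h, Function.update_apply]
    split_ifs <;> simp_all

theorem Generic.clockAt_succ {e : K × ℕ → ℝ} (he : Generic e) (i : ℕ) :
    clockAt (Function.curry e) (i + 1) =
      clockAt (Function.curry (OrientedSwap.restart e)) i := by
  rw [clockAt, he.ringCount_succ, he.nextClock_restart, clockAt]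

theorem Generic.timeAt_zero {e : K × ℕ → ℝ} (he : Generic e) :
    timeAt (Function.curry e) 0 = firstRing e := by
  rw [timeAt, he.clockAt_zero]
  simp [ringCount, ringTime, firstRing]

theorem Generic.timeAt_succ {e : K × ℕ → ℝ} (he : Generic e) (i : ℕ) :
    timeAt (Function.curry e) (i + 1) =
      firstRing e + timeAt (Function.curry (OrientedSwap.restart e)) i := by
  classical
  rw [timeAt, timeAt, he.clockAt_succ, he.ringCount_succ]
  conv_rhs => rw [OrientedSwap.restart, ringTime_residual, firstRing]
  simp only [OrientedSwap.restart, add_sub_cancel]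
  congr!

theorem Generic.stateBefore_succ {e : K × ℕ → ℝ} (he : Generic e) (act : K → X → X) (x : X)
    (i : ℕ) :
    stateBefore act x (Function.curry e) (i + 1) =
      stateBefore act (act (firstClock e) x) (Function.curry (OrientedSwap.restart e)) i := by
  induction i with
  | zero => simp [stateBefore, he.clockAt_zero]
  | succ i ih => rw [stateBefore, ih, he.clockAt_succ]; rfl

theorem Generic.successTimes_eq {e : K × ℕ → ℝ} (he : Generic e) (act : K → X → X) (x : X)
    (l : K) :
    successTimes act x (Function.curry e) l =
      {t | firstClock e = l ∧ act l x ≠ x ∧ firstRing e = t} ∪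
        (firstRing e + ·) '' successTimes act (act (firstClock e) x)
          (Function.curry (OrientedSwap.restart e)) l := by
  ext t
  simp only [successTimes, Set.mem_union, Set.mem_image, Set.mem_ofPred_eq]
  constructor
  · rintro ⟨i, hi, ha, ht⟩
    cases i with
    | zero =>
      left
      rw [he.clockAt_zero] at hi
      rw [he.timeAt_zero] at ht
      exact ⟨hi, ha, ht⟩
    | succ i =>
      right
      rw [he.clockAt_succ] at hi
      rw [he.timeAt_succ] at ht
      rw [he.stateBefore_succ] at ha
      exact ⟨_, ⟨i, hi, ha, rfl⟩, ht⟩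
  · rintro (⟨hi, ha, ht⟩ | ⟨_, ⟨i, hi, ha, rfl⟩, ht⟩)
    · exact ⟨0, he.clockAt_zero.trans hi, ha, he.timeAt_zero.trans ht⟩
    · refine ⟨i + 1, (he.clockAt_succ i).trans hi, ?_, (he.timeAt_succ i).trans ht⟩
      rwa [he.stateBefore_succ]

end Restart

/-! ## Jumps of the dynamics -/

section Jumps

variable {K X : Type*} [Nonempty K] (act : K → X → X)

/-- The number of rings before the first successful one, from the state `x`. -/
def jumpIdx (x : X) (e : K × ℕ → ℝ) : ℕ := sInf {i | act (firstClock (restart^[i] e)) x ≠ x}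

/-- The clock of the first successful ring. -/
def jumpClock (x : X) (e : K × ℕ → ℝ) : K := firstClock (restart^[jumpIdx act x e] e)

/-- The time of the first successful ring. -/
def jumpTime (x : X) (e : K × ℕ → ℝ) : ℝ :=
  ∑ j ∈ Finset.range (jumpIdx act x e + 1), firstRing (restart^[j] e)

/-- The waiting times seen from the first successful ring. -/
def afterJump (x : X) (e : K × ℕ → ℝ) : K × ℕ → ℝ := restart^[jumpIdx act x e + 1] e

variable {act} {x : X} {e : K × ℕ → ℝ}

theorem jumpIdx_of_ne (h : act (firstClock e) x ≠ x) : jumpIdx act x e = 0 :=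
  Nat.sInf_eq_zero.2 (Or.inl h)

/-- If no ring ever succeeds, `sInf ∅ = 0` breaks the recursion. Hypothesis `h'` excludes this: a
jump clock that changes `x`, for `e` or for `restart e`, exhibits a successful ring. -/
theorem jumpIdx_of_eq (h : act (firstClock e) x = x)
    (h' : act (jumpClock act x e) x ≠ x ∨ act (jumpClock act x (restart e)) x ≠ x) :
    jumpIdx act x e = jumpIdx act x (restart e) + 1 := by
  have h0 : 0 < jumpIdx act x e := by
    by_contra h0
    rcases h' with h' | h'
    · apply h'
      rw [jumpClock, Nat.eq_zero_of_not_pos h0]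
      exact h
    · have hne : {i | act (firstClock (restart^[i] e)) x ≠ x}.Nonempty :=
        ⟨jumpIdx act x (restart e) + 1, h'⟩
      have := Nat.sInf_mem hne
      rw [← jumpIdx, Nat.eq_zero_of_not_pos h0] at this
      exact this h
  rw [jumpIdx, ← Nat.sInf_add (n := 1) (p := fun i => act (firstClock (restart^[i] e)) x ≠ x) h0]
  rfl

theorem jumpClock_of_ne (h : act (firstClock e) x ≠ x) : jumpClock act x e = firstClock e := by
  rw [jumpClock, jumpIdx_of_ne h]; rfl

theorem jumpTime_of_ne (h : act (firstClock e) x ≠ x) : jumpTime act x e = firstRing e := by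
  rw [jumpTime, jumpIdx_of_ne h]; simp

theorem afterJump_of_ne (h : act (firstClock e) x ≠ x) : afterJump act x e = restart e := by
  rw [afterJump, jumpIdx_of_ne h]; rfl

theorem jumpClock_of_eq (h : act (firstClock e) x = x)
    (h' : act (jumpClock act x e) x ≠ x ∨ act (jumpClock act x (restart e)) x ≠ x) :
    jumpClock act x e = jumpClock act x (restart e) := by
  rw [jumpClock, jumpIdx_of_eq h h']; rfl

theorem jumpTime_of_eq (h : act (firstClock e) x = x)
    (h' : act (jumpClock act x e) x ≠ x ∨ act (jumpClock act x (restart e)) x ≠ x) :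
    jumpTime act x e = firstRing e + jumpTime act x (restart e) := by
  rw [jumpTime, jumpIdx_of_eq h h', Finset.sum_range_succ', add_comm]; rfl

theorem afterJump_of_eq (h : act (firstClock e) x = x)
    (h' : act (jumpClock act x e) x ≠ x ∨ act (jumpClock act x (restart e)) x ≠ x) :
    afterJump act x e = afterJump act x (restart e) := by
  rw [afterJump, jumpIdx_of_eq h h']; rfl

theorem Generic.firstRing_pos (he : Generic e) : 0 < firstRing e := he.pos _

variable [Finite K]

theorem Generic.afterJump (he : Generic e) : Generic (afterJump act x e) := he.iterate_restart _

theorem Generic.jumpTime_pos (he : Generic e) : 0 < jumpTime act x e :=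
  Finset.sum_pos (fun j _ => (he.iterate_restart j).firstRing_pos) (by simp)

/-- The rings before the jump fail, so they neither move `x` nor add success times; induction on
their number peels them off. -/
theorem Generic.successTimes_jump (he : Generic e) (h : act (jumpClock act x e) x ≠ x) (l : K) :
    successTimes act x (Function.curry e) l =
      {t | jumpClock act x e = l ∧ jumpTime act x e = t} ∪
        (jumpTime act x e + ·) '' successTimes act (act (jumpClock act x e) x)
          (Function.curry (OrientedSwap.afterJump act x e)) l := by
  induction hi : jumpIdx act x e generalizing e with
  | zero =>
    have h0 : act (firstClock e) x ≠ x := by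
      rw [jumpClock, hi] at h
      exact h
    rw [jumpClock_of_ne h0, jumpTime_of_ne h0, afterJump_of_ne h0, he.successTimes_eq]
    congr 1
    ext t
    simp only [Set.mem_ofPred_eq]
    constructor
    · rintro ⟨rfl, -, rfl⟩
      exact ⟨rfl, rfl⟩
    · rintro ⟨rfl, rfl⟩
      exact ⟨rfl, h0, rfl⟩
  | succ i ih =>
    have h0 : act (firstClock e) x = x := by
      by_contra h0
      rw [jumpIdx_of_ne h0] at hi
      omega
    have h1 := jumpIdx_of_eq h0 (Or.inl h)
    rw [he.successTimes_eq, h0]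
    rw [jumpTime_of_eq h0 (Or.inl h), afterJump_of_eq h0 (Or.inl h)]
    have hc := jumpClock_of_eq h0 (Or.inl h)
    rw [hc] at h ⊢
    rw [ih he.restart h (by omega), Set.image_union, Set.image_image, ← Set.union_assoc]
    congr 1
    · ext t
      simp only [Set.mem_union, Set.mem_image, Set.mem_ofPred_eq]
      constructor
      · rintro (⟨rfl, h2, -⟩ | ⟨_, ⟨h2, rfl⟩, rfl⟩)
        · exact absurd h0 h2
        · exact ⟨h2, rfl⟩
      · rintro ⟨h2, rfl⟩
        exact Or.inr ⟨_, ⟨h2, rfl⟩, rfl⟩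
    · simp only [add_assoc]

end Jumps

/-! ## Words of successful rings -/

section Words

variable {K X : Type*} (act : K → X → X)

/-- `w` is the list of successful rings of a trajectory from `x` to an absorbing state. -/
def Complete : X → List K → Prop
  | x, [] => ∀ k, act k x = x
  | x, k :: w => act k x ≠ x ∧ Complete (act k x) w

open Classical in
/-- The position in `w`, counted from `1`, of the last occurrence of `l` (and `0` if there is
none). -/
def lastIdx : List K → K → ℕ
  | [], _ => 0
  | k :: w, l => if l ∈ k :: w then lastIdx w l + 1 else 0

/-- Translates positions of last rings into the part of the word still unread, which tells the
coordinates pending at step `j`. -/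
theorem lt_lastIdx_iff (w : List K) (l : K) (j : ℕ) : j < lastIdx w l ↔ l ∈ w.drop j := by
  induction w generalizing j with
  | nil => simp [lastIdx]
  | cons k w ih =>
    rw [lastIdx]
    cases j with
    | zero => split_ifs with h <;> simp_all
    | succ j =>
      rw [List.drop_succ_cons, ← ih]
      split_ifs with h
      · omega
      · have : ¬ 0 < lastIdx w l := by
          rw [ih]
          exact fun h' => h (List.mem_cons_of_mem _ h')
        omega

variable [Nonempty K]

/-- The event that the first successful rings from `x` are those in the list. -/
def follows : X → List K → Set (K × ℕ → ℝ)
  | _, [] => Set.univ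
  | x, k :: w => {e | jumpClock act x e = k ∧ afterJump act x e ∈ follows (act k x) w}

open Classical in
/-- The time of the last ring of `l` among the successful rings `w` from the state `x`. -/
def lastTime : X → List K → (K × ℕ → ℝ) → K → ℝ
  | _, [], _, _ => 0
  | x, k :: w, e, l =>
    if l ∈ k :: w then jumpTime act x e + lastTime (act k x) w (afterJump act x e) l else 0

variable {act}

/-- A complete word ends in an absorbing state, so it is not a proper prefix of another one; each
letter is dictated by `e`. -/
theorem Complete.unique {x : X} {w w' : List K} (h : Complete act x w) (h' : Complete act x w')
    {e : K × ℕ → ℝ} (he : e ∈ follows act x w) (he' : e ∈ follows act x w') : w = w' := by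
  induction w generalizing x w' e with
  | nil =>
    cases w' with
    | nil => rfl
    | cons k w' => exact absurd (h k) h'.1
  | cons k w ih =>
    cases w' with
    | nil => exact absurd (h' k) h.1
    | cons k' w' =>
      obtain rfl : k = k' := he.1.symm.trans he'.1
      rw [ih h.2 h'.2 he.2 he'.2]

theorem lastTime_of_notMem {x : X} {w : List K} {l : K} (h : l ∉ w) (e : K × ℕ → ℝ) :
    lastTime act x w e l = 0 := by
  cases w with
  | nil => rfl
  | cons k w => rw [lastTime, if_neg h]

variable [Finite K]

theorem Generic.lastTime_nonneg {e : K × ℕ → ℝ} (he : Generic e) (x : X) (w : List K) (l : K) :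
    0 ≤ lastTime act x w e l := by
  induction w generalizing x e with
  | nil => rfl
  | cons k w ih =>
    rw [lastTime]
    split_ifs
    · exact add_nonneg he.jumpTime_pos.le (ih he.afterJump _)
    · rfl

/-- Jump times are strictly positive, so last times are ordered like last positions, and the
defaults `0` for absent letters are compatible with this. -/
theorem Generic.lastTime_lt_iff {e : K × ℕ → ℝ} (he : Generic e) (x : X) (w : List K) (l l' : K) :
    lastTime act x w e l < lastTime act x w e l' ↔ lastIdx w l < lastIdx w l' := by
  induction w generalizing x e with
  | nil => simp [lastTime, lastIdx]
  | cons k w ih =>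
    have hp := he.jumpTime_pos (act := act) (x := x)
    rw [lastTime, lastTime, lastIdx, lastIdx]
    have h1 := he.afterJump.lastTime_nonneg (act := act) (act k x) w l (e := OrientedSwap.afterJump act x e)
    have h2 := he.afterJump.lastTime_nonneg (act := act) (act k x) w l' (e := OrientedSwap.afterJump act x e)
    split_ifs
    · rw [add_lt_add_iff_left, add_lt_add_iff_right]
      exact ih he.afterJump _
    · exact iff_of_false (by linarith) (by omega)
    · exact iff_of_true (by linarith) (by omega)
    · simp

theorem successTimes_of_absorbing {e : K × ℕ → ℝ} {x : X}
    (h : ∀ k, act k x = x) (l : K) : successTimes act x (Function.curry e) l = ∅ := by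
  have hs : ∀ i, stateBefore act x (Function.curry e) i = x := by
    intro i
    induction i with
    | zero => rfl
    | succ i ih => rw [stateBefore, ih, h]
  ext t
  simp only [successTimes, Set.mem_ofPred_eq, Set.mem_empty_iff_false, iff_false]
  rintro ⟨i, -, hi, -⟩
  rw [hs] at hi
  exact hi (h l)

/-- Along a complete word the successes are exactly its letters; afterwards the state is absorbing
and no further success time appears. -/
theorem Generic.successTimes_follows {e : K × ℕ → ℝ} (he : Generic e) {x : X} {w : List K}
    (hw : Complete act x w) (hf : e ∈ follows act x w) (l : K) :
    (l ∉ w → successTimes act x (Function.curry e) l = ∅) ∧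
      (l ∈ w → IsGreatest (successTimes act x (Function.curry e) l) (lastTime act x w e l)) := by
  induction w generalizing x e with
  | nil => simp [successTimes_of_absorbing hw]
  | cons k w ih =>
    obtain ⟨h1, h2⟩ := ih he.afterJump hw.2 hf.2
    have hk : act (jumpClock act x e) x ≠ x := by rw [hf.1]; exact hw.1
    have hs := he.successTimes_jump hk l
    rw [hf.1] at hs
    rw [hs]
    refine ⟨fun hl => ?_, fun hl => ?_⟩
    · rw [List.mem_cons, not_or] at hl
      rw [h1 hl.2, Set.image_empty, Set.union_empty]
      ext t
      simp only [Set.mem_ofPred_eq, Set.mem_empty_iff_false, iff_false]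
      exact fun h => hl.1 h.1.symm
    · rw [lastTime, if_pos hl]
      by_cases hlw : l ∈ w
      · obtain ⟨hm, hu⟩ := h2 hlw
        refine ⟨Or.inr ⟨_, hm, rfl⟩, ?_⟩
        rintro t (⟨-, rfl⟩ | ⟨s, hs, rfl⟩)
        · have := he.afterJump.lastTime_nonneg (act := act) (act k x) w l (e := OrientedSwap.afterJump act x e)
          linarith
        · have := hu hs
          dsimp only
          linarith
      · obtain rfl : l = k := (List.mem_cons.1 hl).resolve_right hlw
        rw [h1 hlw, lastTime_of_notMem hlw, Set.image_empty, Set.union_empty, add_zero]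
        exact ⟨⟨rfl, rfl⟩, fun t ht => ht.2.ge⟩

theorem Generic.sSup_successTimes {e : K × ℕ → ℝ} (he : Generic e) {x : X} {w : List K}
    (hw : Complete act x w) (hf : e ∈ follows act x w) (l : K) :
    sSup (successTimes act x (Function.curry e) l) = lastTime act x w e l := by
  obtain ⟨h1, h2⟩ := he.successTimes_follows hw hf l
  by_cases h : l ∈ w
  · exact (h2 h).csSup_eq
  -- For an absent letter the supremum of the empty set and the default of `lastTime` are both zero.
  · rw [h1 h, lastTime_of_notMem h, Real.sSup_empty]

end Words

/-! ## The exponential law -/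

section Exponential

instance : IsProbabilityMeasure (expMeasure 1) := isProbabilityMeasure_expMeasure one_pos

theorem expMeasure_one :
    expMeasure 1 = (volume.restrict (Set.Ioi 0)).withDensity
      fun y : ℝ => ENNReal.ofReal (Real.exp (-y)) := by
  have h : expMeasure 1 = volume.withDensity (exponentialPDF 1) := rfl
  rw [h, restrict_Ioi_eq_restrict_Ici, ← withDensity_indicator measurableSet_Ici]
  congr 1
  ext y
  rw [exponentialPDF_eq]
  by_cases hy : 0 ≤ y <;> simp [Set.indicator, hy]

theorem expMeasure_one_apply {t : Set ℝ} (ht : MeasurableSet t) :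
    expMeasure 1 t = ∫⁻ y, (Set.Ioi 0 ∩ t).indicator (fun y => ENNReal.ofReal (Real.exp (-y))) y := by
  rw [expMeasure_one, withDensity_apply _ ht, Measure.restrict_restrict ht, Set.inter_comm,
    lintegral_indicator (measurableSet_Ioi.inter ht)]

/-- The exponential law is memoryless. -/
theorem expMeasure_one_shift {t : Set ℝ} (ht : MeasurableSet t) {s : ℝ} (hs : 0 ≤ s) :
    expMeasure 1 {y | s < y ∧ y - s ∈ t} = ENNReal.ofReal (Real.exp (-s)) * expMeasure 1 t := by
  have hm : MeasurableSet {y | s < y ∧ y - s ∈ t} :=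
    measurableSet_Ioi.inter ((measurable_id.sub_const s) ht)
  -- Translate the left integral by `s`; the density then splits as `exp (-s) * exp (-y)`.
  rw [expMeasure_one_apply hm, expMeasure_one_apply ht,
    ← lintegral_add_right_eq_self _ s, ← lintegral_const_mul]
  · congr 1
    ext y
    by_cases h : 0 < y ∧ y ∈ t
    · rw [Set.indicator_of_mem, Set.indicator_of_mem]
      · rw [← ENNReal.ofReal_mul (Real.exp_pos _).le, ← Real.exp_add]
        congr 2
        ring
      · exact h
      · refine ⟨?_, ?_, ?_⟩
        · simp only [Set.mem_Ioi]; linarith [h.1]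
        · linarith [h.1]
        · simpa using h.2
    · rw [Set.indicator_of_notMem, Set.indicator_of_notMem, mul_zero]
      · exact h
      · rintro ⟨-, h1, h2⟩
        exact h ⟨by linarith, by simpa using h2⟩
  · exact Measurable.indicator (by fun_prop) (measurableSet_Ioi.inter ht)

theorem expMeasure_one_Ioi_zero : ∀ᵐ y ∂expMeasure 1, 0 < y := by
  rw [expMeasure_one]
  exact (withDensity_absolutelyContinuous _ _) (ae_restrict_mem measurableSet_Ioi)

instance : NullSingletonClass (expMeasure 1) := by
  rw [expMeasure_one]; infer_instance

theorem integral_expMeasure_one (f : ℝ → ℂ) :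
    ∫ y, f y ∂expMeasure 1 = ∫ y in Set.Ioi (0 : ℝ), Complex.exp (-y) * f y := by
  rw [expMeasure_one]
  have h := integral_withDensity_eq_integral_toReal_smul
    (μ := volume.restrict (Set.Ioi (0 : ℝ))) (f := fun y : ℝ => ENNReal.ofReal (Real.exp (-y)))
    (by fun_prop) (by simp) f
  rw [h]
  congr 1
  ext y
  rw [ENNReal.toReal_ofReal (Real.exp_pos _).le, Complex.real_smul]
  simp

end Exponential

/-! ## The law of independent Poisson clocks -/

section ClockLaw

/-- The joint law of the waiting times of independent Poisson clocks of rate one. -/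
def clockLaw (K : Type*) : Measure (K × ℕ → ℝ) := Measure.infinitePi fun _ => expMeasure 1

variable {K : Type*}

instance : IsProbabilityMeasure (clockLaw K) := by unfold clockLaw; infer_instance

open Classical in
/-- Insert a new first waiting time of the clock `k`. -/
def prependWait (k : K) (q : (K × ℕ → ℝ) × ℝ) : K × ℕ → ℝ := fun p =>
  if p.1 = k then if p.2 = 0 then q.2 else q.1 (k, p.2 - 1) else q.1 p

open Classical in
/-- The index at which `prependWait` puts a waiting time. -/
def prependIdx (k : K) (p : K × ℕ) : K × ℕ := if p.1 = k then (k, p.2 + 1) else p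

theorem prependIdx_injective (k : K) : Function.Injective (prependIdx k) := by
  rintro ⟨a, m⟩ ⟨b, m'⟩ h
  unfold prependIdx at h
  split_ifs at h <;> simp_all

theorem exists_prependIdx {k : K} {p : K × ℕ} (h : p ≠ (k, 0)) : ∃ q, prependIdx k q = p := by
  obtain ⟨l, m⟩ := p
  by_cases hl : l = k
  · subst hl
    cases m with
    | zero => exact absurd rfl h
    | succ m => exact ⟨(l, m), by simp [prependIdx]⟩
  · exact ⟨(l, m), by simp [prependIdx, hl]⟩

theorem prependWait_prependIdx (k : K) (q : (K × ℕ → ℝ) × ℝ) (p : K × ℕ) :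
    prependWait k q (prependIdx k p) = q.1 p := by
  obtain ⟨l, m⟩ := p
  by_cases h : l = k <;> simp [prependWait, prependIdx, h]

theorem prependWait_self (k : K) (q : (K × ℕ → ℝ) × ℝ) : prependWait k q (k, 0) = q.2 := by
  simp [prependWait]

theorem measurable_prependWait (k : K) : Measurable (prependWait k) := by
  refine measurable_pi_lambda _ fun p => ?_
  unfold prependWait
  split_ifs <;> fun_prop

/-- Putting a fresh exponential in front of clock `k` only reindexes a product of identical laws.
This lets Fubini isolate the first waiting time of `k`. -/
theorem map_prependWait (k : K) :
    ((clockLaw K).prod (expMeasure 1)).map (prependWait k) = clockLaw K := by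
  classical
  refine Measure.eq_infinitePi _ fun S t ht => ?_
  rw [Measure.map_apply (measurable_prependWait k)
    (MeasurableSet.pi S.countable_toSet fun i _ => ht i)]
  have hpre : prependWait k ⁻¹' (Set.pi S t) =
      Set.pi ((S.erase (k, 0)).preimage (prependIdx k) (prependIdx_injective k).injOn)
        (fun p => t (prependIdx k p)) ×ˢ (if (k, 0) ∈ S then t (k, 0) else Set.univ) := by
    ext q
    simp only [Set.mem_preimage, Set.mem_pi, Finset.mem_coe, Set.mem_prod, Finset.mem_preimage,
      Finset.mem_erase]
    constructor
    · refine fun h => ⟨fun p hp => ?_, ?_⟩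
      · simpa [prependWait_prependIdx] using h _ hp.2
      · split_ifs with hk
        · simpa [prependWait_self] using h _ hk
        · trivial
    · rintro ⟨h1, h2⟩ p hp
      by_cases hpk : p = (k, 0)
      · subst hpk
        rw [if_pos hp] at h2
        rwa [prependWait_self]
      · obtain ⟨p', rfl⟩ := exists_prependIdx hpk
        rw [prependWait_prependIdx]
        exact h1 p' ⟨hpk, hp⟩
  rw [hpre, Measure.prod_prod]
  unfold clockLaw
  rw [Measure.infinitePi_pi _ (fun i _ => ht _),
    Finset.prod_preimage' _ _ _ (fun p => expMeasure 1 (t p)), Finset.filter_true_of_mem]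
  · split_ifs with h
    · rw [mul_comm, Finset.mul_prod_erase S (fun p => expMeasure 1 (t p)) h]
    · rw [measure_univ, mul_one, Finset.erase_eq_of_notMem h]
  · intro p hp
    exact exists_prependIdx (Finset.ne_of_mem_erase hp)

open Classical in
/-- Subtract `s` from the first waiting times of all the clocks but `k`. -/
def advance (k : K) (s : ℝ) (f : K × ℕ → ℝ) : K × ℕ → ℝ := fun p =>
  if p.1 ≠ k ∧ p.2 = 0 then f p - s else f p

/-- All the clocks but `k` ring for the first time after the time `s`. -/
def Waiting (k : K) (s : ℝ) : Set (K × ℕ → ℝ) := {f | ∀ l, l ≠ k → s < f (l, 0)}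

theorem measurable_advance (k : K) (s : ℝ) : Measurable (advance k s) := by
  refine measurable_pi_lambda _ fun p => ?_
  unfold advance
  split_ifs <;> fun_prop

theorem measurableSet_waiting [Finite K] (k : K) (s : ℝ) : MeasurableSet (Waiting k s) := by
  unfold Waiting
  simp only [Set.ofPred_forall]
  exact MeasurableSet.iInter fun l => MeasurableSet.iInter fun _ =>
    measurableSet_lt measurable_const (measurable_pi_apply _)

theorem ringsFirst_prependWait {k : K} {q : (K × ℕ → ℝ) × ℝ} :
    RingsFirst (prependWait k q) k ↔ q.1 ∈ Waiting k q.2 := by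
  refine forall₂_congr fun l hl => ?_
  rw [prependWait_self]
  simp [prependWait, hl]

theorem residual_prependWait (k : K) (q : (K × ℕ → ℝ) × ℝ) :
    residual k (prependWait k q) = advance k q.2 q.1 := by
  funext p
  obtain ⟨l, m⟩ := p
  by_cases h : l = k <;> by_cases hm : m = 0 <;> simp [residual, advance, prependWait, h, hm]

/-- Memorylessness for all the other clocks at once: each of the `card K - 1` of them survives `s`
with weight `exp (-s)` and then starts afresh, while clock `k` is untouched. -/
theorem clockLaw_waiting_advance [Fintype K] (k : K) {s : ℝ} (hs : 0 ≤ s) :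
    ((clockLaw K).restrict (Waiting k s)).map (advance k s) =
      ENNReal.ofReal (Real.exp (-s)) ^ (Fintype.card K - 1) • clockLaw K := by
  classical
  set c := ENNReal.ofReal (Real.exp (-s)) with hc
  have hc0 : c ≠ 0 := by simp [hc, Real.exp_pos]
  have hct : c ≠ ⊤ := ENNReal.ofReal_ne_top
  set N := Fintype.card K - 1 with hN
  -- After division by the mass, `Measure.eq_infinitePi` identifies the measure from its values on
  -- finite boxes.
  have key : (c ^ N)⁻¹ • ((clockLaw K).restrict (Waiting k s)).map (advance k s) =
      clockLaw K := by
    refine Measure.eq_infinitePi _ fun S t ht => ?_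
    have hpi : MeasurableSet (Set.pi (S : Set (K × ℕ)) t) :=
      MeasurableSet.pi S.countable_toSet fun i _ => ht i
    rw [Measure.smul_apply, Measure.map_apply (measurable_advance k s) hpi,
      Measure.restrict_apply (measurable_advance k s hpi)]
    set L : Finset (K × ℕ) := (Finset.univ.erase k).map ⟨fun l => (l, 0), fun a b h => by
      simpa using h⟩ with hL
    have hmemL : ∀ p : K × ℕ, p ∈ L ↔ p.1 ≠ k ∧ p.2 = 0 := by
      rintro ⟨l, m⟩
      simp only [hL, Finset.mem_map, Finset.mem_erase, Finset.mem_univ, and_true]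
      constructor
      · rintro ⟨a, ha, h⟩
        obtain ⟨rfl, rfl⟩ := Prod.mk.inj h
        exact ⟨ha, rfl⟩
      · rintro ⟨h1, h2⟩
        exact ⟨l, h1, Prod.ext rfl h2.symm⟩
    -- Survival constrains the waiting times in `L` even outside `S`, so the box is padded with
    -- `Set.univ` and read over `S ∪ L`.
    let t' : K × ℕ → Set ℝ := fun p => if p ∈ S then t p else Set.univ
    have ht' : ∀ p, MeasurableSet (t' p) := fun p => by
      simp only [t']
      split_ifs
      exacts [ht p, MeasurableSet.univ]
    let u : K × ℕ → Set ℝ := fun p => if p ∈ L then {y | s < y ∧ y - s ∈ t' p} else t' p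
    have hset : advance k s ⁻¹' (Set.pi S t) ∩ Waiting k s = Set.pi ↑(S ∪ L) u := by
      ext f
      simp only [Set.mem_inter_iff, Set.mem_preimage, Set.mem_pi, Finset.mem_coe,
        Finset.mem_union, Waiting, Set.mem_ofPred_eq]
      constructor
      · rintro ⟨h1, h2⟩ p hp
        simp only [u]
        split_ifs with hpL
        · have hpL' := (hmemL p).1 hpL
          refine ⟨?_, ?_⟩
          · have := h2 p.1 hpL'.1
            rwa [← hpL'.2] at this
          · simp only [t']
            split_ifs with hpS
            · have := h1 p hpS
              rwa [advance, if_pos hpL'] at this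
            · trivial
        · have hpS := hp.resolve_right hpL
          simp only [t', if_pos hpS]
          have := h1 p hpS
          rwa [advance, if_neg (fun h => hpL ((hmemL p).2 h))] at this
      · refine fun h => ⟨fun p hp => ?_, fun l hl => ?_⟩
        · have := h p (Or.inl hp)
          simp only [u, t', if_pos hp] at this
          rw [advance]
          split_ifs at this with hpL
          · rw [if_pos ((hmemL p).1 hpL)]
            exact this.2
          · rw [if_neg (fun h => hpL ((hmemL p).2 h))]
            exact this
        · have hpL : (l, 0) ∈ L := (hmemL _).2 ⟨hl, rfl⟩
          have := h (l, 0) (Or.inr hpL)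
          simp only [u, if_pos hpL] at this
          exact this.1
    have hu : ∀ p, expMeasure 1 (u p) = (if p ∈ L then c else 1) * expMeasure 1 (t' p) := by
      intro p
      simp only [u]
      split_ifs
      · exact expMeasure_one_shift (ht' p) hs
      · rw [one_mul]
    have hum : ∀ p, MeasurableSet (u p) := by
      intro p
      simp only [u]
      split_ifs
      · exact measurableSet_Ioi.inter ((measurable_id.sub_const s) (ht' p))
      · exact ht' p
    have hcard : L.card = N := by
      rw [hL, Finset.card_map, Finset.card_erase_of_mem (Finset.mem_univ _), Finset.card_univ]
    have h1 : ∏ p ∈ S ∪ L, (if p ∈ L then c else 1) = c ^ N := by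
      rw [← Finset.prod_subset (Finset.subset_union_right (s₁ := S) (s₂ := L))
        (fun p _ hp => if_neg hp), Finset.prod_congr rfl (fun p hp => if_pos hp),
        Finset.prod_const, hcard]
    have h2 : ∏ p ∈ S ∪ L, expMeasure 1 (t' p) = ∏ p ∈ S, expMeasure 1 (t p) := by
      rw [← Finset.prod_subset (Finset.subset_union_left (s₁ := S) (s₂ := L))
        (fun p _ hp => by simp [t', hp])]
      exact Finset.prod_congr rfl fun p hp => by simp only [t', if_pos hp]
    rw [hset]
    unfold clockLaw
    rw [Measure.infinitePi_pi _ (fun i _ => hum i), Finset.prod_congr rfl (fun p _ => hu p),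
      Finset.prod_mul_distrib, h1, h2, smul_eq_mul, ← mul_assoc,
      ENNReal.inv_mul_cancel (pow_ne_zero _ hc0) (ENNReal.pow_ne_top hct), one_mul]
  rw [← key, smul_smul, ENNReal.mul_inv_cancel (pow_ne_zero _ hc0) (ENNReal.pow_ne_top hct),
    one_smul, key]

end ClockLaw

/-! ## Measurability of the jumps -/

section Measurability

variable {K X : Type*} [Nonempty K] [Finite K]

omit [Nonempty K] in
theorem measurableSet_ringsFirst (k : K) : MeasurableSet {e | RingsFirst e k} := by
  unfold RingsFirst
  simp only [Set.ofPred_forall]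
  exact MeasurableSet.iInter fun l => MeasurableSet.iInter fun _ =>
    measurableSet_lt (measurable_pi_apply _) (measurable_pi_apply _)

/-- When no clock is strictly first, `firstClock` is a fixed arbitrary clock, so only the fibre of
that clock gets an extra piece. -/
theorem measurableSet_firstClock (k : K) : MeasurableSet {e | firstClock e = k} := by
  classical
  have h : {e : K × ℕ → ℝ | firstClock e = k} = {e | RingsFirst e k} ∪
      (if Classical.arbitrary K = k then {e | ¬ ∃ l, RingsFirst e l} else ∅) := by
    ext e
    by_cases he : ∃ l, RingsFirst e l
    · obtain ⟨l, hl⟩ := he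
      have h1 : RingsFirst e k ↔ l = k := ⟨fun h => hl.unique h, fun h => h ▸ hl⟩
      have h2 : ∃ l, RingsFirst e l := ⟨l, hl⟩
      simp only [Set.mem_union, Set.mem_ofPred_eq, hl.firstClock_eq, h1]
      split_ifs <;> simp [h2]
    · have h1 : ¬ RingsFirst e k := fun h => he ⟨k, h⟩
      simp only [Set.mem_union, Set.mem_ofPred_eq, firstClock, dif_neg he, h1, false_or]
      split_ifs with h
      · simpa [h] using he
      · simp [h]
  rw [h]
  refine (measurableSet_ringsFirst k).union ?_
  split_ifs
  · have : {e : K × ℕ → ℝ | ∃ l, RingsFirst e l} = ⋃ l, {e | RingsFirst e l} := by ext; simp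
    exact (this ▸ MeasurableSet.iUnion measurableSet_ringsFirst :
      MeasurableSet {e : K × ℕ → ℝ | ∃ l, RingsFirst e l}).compl
  · exact MeasurableSet.empty

/-- A function that is measurable on each piece of a countable measurable partition. -/
theorem measurable_of_countable_partition {α β ι : Type*} [MeasurableSpace α] [MeasurableSpace β]
    [Countable ι] {c : α → ι} (hc : ∀ i, MeasurableSet {a | c a = i}) {f : ι → α → β}
    (hf : ∀ i, Measurable (f i)) : Measurable fun a => f (c a) a := by
  intro s hs
  have : (fun a => f (c a) a) ⁻¹' s = ⋃ i, {a | c a = i} ∩ f i ⁻¹' s := by ext; simp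
  rw [this]
  exact MeasurableSet.iUnion fun i => (hc i).inter (hf i hs)

omit [Nonempty K] [Finite K] in
theorem measurable_residual (k : K) : Measurable (residual k) := by
  refine measurable_pi_lambda _ fun p => ?_
  unfold residual
  split_ifs <;> fun_prop

theorem measurable_restart : Measurable (restart (K := K)) :=
  measurable_of_countable_partition measurableSet_firstClock measurable_residual

theorem measurable_firstRing : Measurable (firstRing (K := K)) :=
  measurable_of_countable_partition (f := fun k (e : K × ℕ → ℝ) => e (k, 0))
    measurableSet_firstClock fun _ => measurable_pi_apply _

variable (act : K → X → X) (x : X)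

/-- The extra piece for `i = 0` is the event that no ring succeeds, where `sInf ∅ = 0`. -/
theorem measurableSet_jumpIdx (i : ℕ) : MeasurableSet {e | jumpIdx act x e = i} := by
  classical
  have hA : ∀ j, MeasurableSet {e : K × ℕ → ℝ | act (firstClock (restart^[j] e)) x ≠ x} := by
    intro j
    have : {e : K × ℕ → ℝ | act (firstClock (restart^[j] e)) x ≠ x} =
        restart^[j] ⁻¹' ⋃ k : {k // act k x ≠ x}, {e | firstClock e = k.1} := by
      ext e
      simp
    rw [this]
    exact (measurable_restart.iterate j)
      (MeasurableSet.iUnion fun k => measurableSet_firstClock k.1)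
  have h : {e : K × ℕ → ℝ | jumpIdx act x e = i} =
      ({e | act (firstClock (restart^[i] e)) x ≠ x} ∩
        ⋂ j, ⋂ (_ : j < i), {e | act (firstClock (restart^[j] e)) x ≠ x}ᶜ) ∪
      (if i = 0 then ⋂ j, {e | act (firstClock (restart^[j] e)) x ≠ x}ᶜ else ∅) := by
    ext e
    by_cases he : {j | act (firstClock (restart^[j] e)) x ≠ x}.Nonempty
    · have h0 : e ∉ (if i = 0 then ⋂ j, {e | act (firstClock (restart^[j] e)) x ≠ x}ᶜ else ∅) := by
        split_ifs
        · obtain ⟨j, hj⟩ := he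
          rw [Set.mem_iInter]
          exact fun h => h j hj
        · simp
      rw [Set.mem_union, or_iff_left h0]
      simp only [Set.mem_ofPred_eq, Set.mem_inter_iff, Set.mem_iInter, Set.mem_compl_iff]
      constructor
      · rintro rfl
        exact ⟨Nat.sInf_mem he, fun j hj => Nat.notMem_of_lt_sInf hj⟩
      · rintro ⟨h1, h2⟩
        refine le_antisymm (Nat.sInf_le h1) ?_
        by_contra hlt
        exact h2 _ (not_le.1 hlt) (Nat.sInf_mem he)
    · have he' : ∀ j, ¬ act (firstClock (restart^[j] e)) x ≠ x := fun j hj => he ⟨j, hj⟩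
      have h0 : jumpIdx act x e = 0 :=
        Nat.sInf_eq_zero.2 (Or.inr (Set.not_nonempty_iff_eq_empty.1 he))
      simp only [Set.mem_ofPred_eq, h0, Set.mem_union, Set.mem_inter_iff, he', false_and, false_or]
      split_ifs with hi
      · simpa [hi] using fun j => not_not.1 (he' j)
      · simp [Ne.symm hi]
  rw [h]
  refine ((hA i).inter (MeasurableSet.iInter fun j => MeasurableSet.iInter fun _ =>
    (hA j).compl)).union ?_
  split_ifs
  · exact MeasurableSet.iInter fun j => (hA j).compl
  · exact MeasurableSet.empty

theorem measurableSet_jumpClock (k : K) : MeasurableSet {e | jumpClock act x e = k} := by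
  have : {e | jumpClock act x e = k} =
      ⋃ i, {e | jumpIdx act x e = i} ∩ restart^[i] ⁻¹' {e | firstClock e = k} := by
    ext e
    simp [jumpClock]
  rw [this]
  exact MeasurableSet.iUnion fun i => (measurableSet_jumpIdx act x i).inter
    (measurable_restart.iterate i (measurableSet_firstClock k))

theorem measurable_jumpTime : Measurable (jumpTime act x) :=
  measurable_of_countable_partition
    (f := fun i (e : K × ℕ → ℝ) => ∑ j ∈ Finset.range (i + 1), firstRing (restart^[j] e))
    (measurableSet_jumpIdx act x) fun _ => Finset.measurable_sum _ fun j _ =>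
      measurable_firstRing.comp (measurable_restart.iterate j)

theorem measurable_afterJump : Measurable (afterJump act x) :=
  measurable_of_countable_partition (f := fun i (e : K × ℕ → ℝ) => restart^[i + 1] e)
    (measurableSet_jumpIdx act x) fun i => measurable_restart.iterate (i + 1)

theorem measurableSet_follows (w : List K) : MeasurableSet (follows act x w) := by
  induction w generalizing x with
  | nil => exact MeasurableSet.univ
  | cons k w ih =>
    exact (measurableSet_jumpClock act x k).inter (measurable_afterJump act x (ih _))

theorem measurable_lastTime (w : List K) (l : K) :
    Measurable fun e => lastTime act x w e l := by
  induction w generalizing x with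
  | nil => exact measurable_const
  | cons k w ih =>
    simp only [lastTime]
    split_ifs
    · exact (measurable_jumpTime act x).add ((ih _).comp (measurable_afterJump act x))
    · exact measurable_const

end Measurability

/-! ## The law of the jumps -/

section JumpLaw

variable {K X : Type*} [Fintype K]

/-- With all waiting times frozen except the first one of `k`, a tie between `k` and `l` pins that
one to a single value, and the exponential law has no atoms. -/
theorem ae_generic : ∀ᵐ e ∂clockLaw K, Generic e := by
  have hpos : ∀ᵐ e ∂clockLaw K, ∀ p, 0 < e p := by
    rw [ae_all_iff]
    exact fun p => (measurePreserving_eval_infinitePi (fun _ : K × ℕ => expMeasure 1) p)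
      |>.quasiMeasurePreserving.ae expMeasure_one_Ioi_zero
  have hring : ∀ (k : K) (m : ℕ),
      Measurable fun e : K × ℕ → ℝ => ringTime (Function.curry e) k m := fun k m =>
    Finset.measurable_sum _ fun i _ => measurable_pi_apply (k, i)
  have hne : ∀ᵐ e ∂clockLaw K, ∀ (k l : K) (m m' : ℕ), k ≠ l →
      ringTime (Function.curry e) k m ≠ ringTime (Function.curry e) l m' := by
    simp only [ae_all_iff]
    intro k l m m' hkl
    rw [← map_prependWait k]
    have hms : MeasurableSet {e : K × ℕ → ℝ |
        ringTime (Function.curry e) k m ≠ ringTime (Function.curry e) l m'} :=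
      (measurableSet_eq_fun (hring k m) (hring l m')).compl
    rw [ae_map_iff (measurable_prependWait k).aemeasurable hms, ae_iff]
    have hms' : MeasurableSet {q : (K × ℕ → ℝ) × ℝ |
        ringTime (Function.curry (prependWait k q)) k m =
          ringTime (Function.curry (prependWait k q)) l m'} :=
      measurableSet_eq_fun ((hring k m).comp (measurable_prependWait k))
        ((hring l m').comp (measurable_prependWait k))
    simp only [ne_eq, not_not]
    rw [Measure.measure_prod_null hms']
    refine Filter.Eventually.of_forall fun f => ?_
    refine measure_mono_null (t := {ringTime (Function.curry f) l m' -
      ∑ i ∈ Finset.range m, f (k, i)}) (fun s hs => ?_) (measure_singleton _)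
    simp only [Set.mem_preimage, Set.mem_ofPred_eq, ringTime, Function.curry_apply] at hs
    rw [Finset.sum_range_succ'] at hs
    simp only [prependWait, if_true, hkl.symm, if_false, Nat.succ_ne_zero,
      Nat.add_sub_cancel] at hs
    simp only [Set.mem_singleton_iff, ringTime, Function.curry_apply]
    linarith
  filter_upwards [hpos, hne] with e h1 h2
  exact ⟨h1, h2⟩

/-- A complex exponential wave. -/
def wave (y t : ℝ) : ℂ := Complex.exp (-((y * t : ℝ) * Complex.I))

theorem wave_add (y s t : ℝ) : wave y (s + t) = wave y s * wave y t := by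
  rw [wave, wave, wave, ← Complex.exp_add]
  congr 1
  push_cast
  ring

theorem norm_wave (y t : ℝ) : ‖wave y t‖ = 1 := by
  rw [wave, ← neg_mul, ← Complex.ofReal_neg, Complex.norm_exp_ofReal_mul_I]

theorem wave_zero (y : ℝ) : wave y 0 = 1 := by simp [wave]

@[fun_prop]
theorem measurable_wave (y : ℝ) : Measurable (wave y) := by unfold wave; fun_prop

/-- When `r` counts the competing clocks, `exp (-(r * s))` is the probability that all of them wait
beyond `s`. -/
theorem integral_wave (y r : ℝ) (hr : 0 ≤ r) :
    ∫ s, wave y s * (Real.exp (-(r * s)) : ℂ) ∂expMeasure 1 = (r + 1 + y * Complex.I)⁻¹ := by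
  rw [integral_expMeasure_one]
  have h : ∀ s : ℝ, Complex.exp (-s) * (wave y s * (Real.exp (-(r * s)) : ℂ)) =
      Complex.exp (-(r + 1 + y * Complex.I) * s) := by
    intro s
    rw [wave, Complex.ofReal_exp, ← Complex.exp_add, ← Complex.exp_add]
    congr 1
    push_cast
    ring
  simp only [h]
  rw [integral_exp_mul_complex_Ioi]
  · simp only [Complex.ofReal_zero, mul_zero, Complex.exp_zero, neg_div_neg_eq, one_div]
  · simp
    linarith

variable [Nonempty K]

theorem ae_firstClock_iff (k : K) :
    {e : K × ℕ → ℝ | firstClock e = k} =ᵐ[clockLaw K] {e | RingsFirst e k} := by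
  filter_upwards [ae_generic] with e he
  refine propext ⟨fun h => ?_, fun h => h.firstClock_eq⟩
  have := he.ringsFirst
  rwa [show firstClock e = k from h] at this

/-- Condition on the first waiting time `s` of `k`: the other clocks must survive `s`, and by
`clockLaw_waiting_advance` the restarted clocks have the original law. The restart is thus
independent of which clock rang and when. -/
theorem setIntegral_firstClock (k : K) (y : ℝ) {G : (K × ℕ → ℝ) → ℂ} (hG : Measurable G)
    {C : ℝ} (hC : ∀ e, ‖G e‖ ≤ C) :
    ∫ e in {e | firstClock e = k}, wave y (firstRing e) * G (restart e) ∂clockLaw K =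
      (∫ e, G e ∂clockLaw K) / (Fintype.card K + y * Complex.I) := by
  have hcard : 1 ≤ Fintype.card K := Fintype.card_pos
  have hmeas : Measurable fun e : K × ℕ → ℝ => wave y (e (k, 0)) * G (residual k e) :=
    ((measurable_wave y).comp (measurable_pi_apply _)).mul (hG.comp (measurable_residual k))
  have h1 : ∫ e in {e | firstClock e = k}, wave y (firstRing e) * G (restart e) ∂clockLaw K =
      ∫ e in {e | RingsFirst e k}, wave y (e (k, 0)) * G (residual k e) ∂clockLaw K := by
    rw [← setIntegral_congr_set (ae_firstClock_iff k)]
    refine setIntegral_congr_fun (measurableSet_firstClock k) fun e he => ?_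
    have he' : firstClock e = k := he
    simp only [firstRing, restart, he']
  have hind := hmeas.indicator (measurableSet_ringsFirst k)
  rw [h1, ← integral_indicator (measurableSet_ringsFirst k)]
  conv_lhs => rw [← map_prependWait k]
  rw [integral_map (measurable_prependWait k).aemeasurable hind.aestronglyMeasurable,
    integral_prod_symm]
  · have h2 : ∀ᵐ s ∂expMeasure 1, ∫ f, {e | RingsFirst e k}.indicator
        (fun e => wave y (e (k, 0)) * G (residual k e)) (prependWait k (f, s)) ∂clockLaw K =
        wave y s * (Real.exp (-((Fintype.card K - 1 : ℕ) * s)) : ℂ) * ∫ f, G f ∂clockLaw K := by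
      filter_upwards [expMeasure_one_Ioi_zero] with s hs
      have h3 : (fun f => {e | RingsFirst e k}.indicator
          (fun e => wave y (e (k, 0)) * G (residual k e)) (prependWait k (f, s))) =
          (Waiting k s).indicator fun f => wave y s * G (advance k s f) := by
        ext f
        by_cases hf : f ∈ Waiting k s
        · rw [Set.indicator_of_mem hf, Set.indicator_of_mem (ringsFirst_prependWait.2 hf),
            prependWait_self, residual_prependWait]
        · rw [Set.indicator_of_notMem hf,
            Set.indicator_of_notMem (fun h => hf (ringsFirst_prependWait.1 h))]
      rw [h3, integral_indicator (measurableSet_waiting k s), integral_const_mul,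
        ← integral_map (measurable_advance k s).aemeasurable hG.aestronglyMeasurable,
        clockLaw_waiting_advance k hs.le, integral_smul_measure, ENNReal.toReal_pow,
        ENNReal.toReal_ofReal (Real.exp_pos _).le, ← Real.exp_nat_mul, mul_neg,
        Complex.real_smul, mul_assoc]
    rw [integral_congr_ae h2, integral_mul_const, integral_wave _ _ (Nat.cast_nonneg _),
      div_eq_inv_mul]
    congr 2
    have : (((Fintype.card K - 1 : ℕ) : ℝ) : ℂ) = Fintype.card K - 1 := by
      rw [Complex.ofReal_natCast, Nat.cast_sub hcard]
      simp
    rw [this]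
    ring
  · refine Integrable.of_bound (hind.comp (measurable_prependWait k)).aestronglyMeasurable C
      (Filter.Eventually.of_forall fun q => ?_)
    have hC0 : 0 ≤ C := (norm_nonneg _).trans (hC 0)
    by_cases hq : RingsFirst (prependWait k q) k
    · rw [Set.indicator_of_mem (by exact hq), norm_mul, norm_wave, one_mul]
      exact hC _
    · rw [Set.indicator_of_notMem (by exact hq), norm_zero]
      exact hC0

open Classical in
/-- The number of clocks whose ring would change the state `x`. -/
def outDegree (act : K → X → X) (x : X) : ℕ := (Finset.univ.filter fun k => act k x ≠ x).card

/-- First-step analysis replaces a geometric series. With `a = card K + y i` and `d` the out-degree,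
each of the `card K - d` ineffective first rings contributes `D / a`, and `k` itself contributes `g
/ a`. Solving this linear equation for `D` leaves the denominator `d + y i`. -/
theorem setIntegral_jumpClock (act : K → X → X) {x : X} {k : K} (hk : act k x ≠ x) (y : ℝ)
    {G : (K × ℕ → ℝ) → ℂ} (hG : Measurable G) {C : ℝ} (hC : ∀ e, ‖G e‖ ≤ C) :
    ∫ e in {e | jumpClock act x e = k}, wave y (jumpTime act x e) * G (afterJump act x e)
        ∂clockLaw K =
      (∫ e, G e ∂clockLaw K) / (outDegree act x + y * Complex.I) := by
  classical
  have hC0 : 0 ≤ C := (norm_nonneg _).trans (hC 0)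
  set F : (K × ℕ → ℝ) → ℂ := {e | jumpClock act x e = k}.indicator
    fun e => wave y (jumpTime act x e) * G (afterJump act x e) with hF
  have hFm : Measurable F := (((measurable_wave y).comp (measurable_jumpTime act x)).mul
    (hG.comp (measurable_afterJump act x))).indicator (measurableSet_jumpClock act x k)
  have hFC : ∀ e, ‖F e‖ ≤ C := by
    intro e
    simp only [hF]
    by_cases he : jumpClock act x e = k
    · rw [Set.indicator_of_mem (by exact he), norm_mul, norm_wave, one_mul]
      exact hC _
    · rw [Set.indicator_of_notMem (by exact he), norm_zero]
      exact hC0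
  have hFi : Integrable F (clockLaw K) :=
    Integrable.of_bound hFm.aestronglyMeasurable C (Filter.Eventually.of_forall hFC)
  rw [← integral_indicator (measurableSet_jumpClock act x k), ← hF]
  set D := ∫ e, F e ∂clockLaw K with hD
  set g := ∫ e, G e ∂clockLaw K with hg
  set a : ℂ := Fintype.card K + y * Complex.I with ha
  have hpart : D = ∑ l, ∫ e in {e | firstClock e = l}, F e ∂clockLaw K := by
    rw [← integral_iUnion_fintype measurableSet_firstClock _ (fun _ => hFi.integrableOn)]
    · have : (⋃ l : K, {e : K × ℕ → ℝ | firstClock e = l}) = Set.univ := by ext; simp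
      rw [this, setIntegral_univ]
    · intro l l' hl
      exact Set.disjoint_left.2 fun e h h' => hl (h.symm.trans h')
  have hpiece : ∀ l, ∫ e in {e | firstClock e = l}, F e ∂clockLaw K =
      (if act l x = x then D / a else 0) + if l = k then g / a else 0 := by
    intro l
    by_cases hl : act l x = x
    · have hlk : l ≠ k := by rintro rfl; exact hk hl
      rw [if_pos hl, if_neg hlk, add_zero, hD, ha, ← setIntegral_firstClock l y hFm hFC]
      refine setIntegral_congr_fun (measurableSet_firstClock l) fun e he => ?_
      have h0 : act (firstClock e) x = x := by rw [show firstClock e = l from he, hl]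
      simp only [hF]
      -- If either jump clock is `k`, some ring succeeds and the recursion applies; otherwise both
      -- indicators vanish.
      by_cases hc : jumpClock act x e = k ∨ jumpClock act x (restart e) = k
      · have hc' : act (jumpClock act x e) x ≠ x ∨ act (jumpClock act x (restart e)) x ≠ x :=
          hc.imp (fun h => by rwa [h]) (fun h => by rwa [h])
        have hcc := jumpClock_of_eq h0 hc'
        have hc1 : jumpClock act x e = k := hc.elim id fun h => hcc.trans h
        rw [Set.indicator_of_mem (by exact hc1), Set.indicator_of_mem (by exact hcc.symm.trans hc1),
          jumpTime_of_eq h0 hc', afterJump_of_eq h0 hc', wave_add, mul_assoc]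
      · rw [not_or] at hc
        rw [Set.indicator_of_notMem (by exact hc.1), Set.indicator_of_notMem (by exact hc.2),
          mul_zero]
    · rw [if_neg hl, zero_add]
      by_cases hlk : l = k
      · subst hlk
        rw [if_pos rfl, hg, ha, ← setIntegral_firstClock l y hG hC]
        refine setIntegral_congr_fun (measurableSet_firstClock l) fun e he => ?_
        have he' : firstClock e = l := he
        have h0 : act (firstClock e) x ≠ x := by rwa [he']
        simp only [hF]
        rw [Set.indicator_of_mem (by exact (jumpClock_of_ne h0).trans he'), jumpTime_of_ne h0,
          afterJump_of_ne h0]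
      · rw [if_neg hlk, ← integral_zero (K × ℕ → ℝ) ℂ
          (μ := (clockLaw K).restrict {e | firstClock e = l})]
        refine setIntegral_congr_fun (measurableSet_firstClock l) fun e he => ?_
        have he' : firstClock e = l := he
        have h0 : act (firstClock e) x ≠ x := by rwa [he']
        simp only [hF]
        rw [Set.indicator_of_notMem]
        exact fun h => hlk (he'.symm.trans ((jumpClock_of_ne h0).symm.trans h))
  have hre : ∀ n : ℕ, 0 < n → (n + y * Complex.I : ℂ) ≠ 0 := by
    intro n hn h
    have := congrArg Complex.re h
    simp at this
    omega
  have ha0 : a ≠ 0 := hre _ Fintype.card_pos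
  have hd : 0 < outDegree act x :=
    Finset.card_pos.2 ⟨k, Finset.mem_filter.2 ⟨Finset.mem_univ _, hk⟩⟩
  have hcount : ((Finset.univ.filter fun l => act l x = x).card : ℂ) =
      Fintype.card K - outDegree act x := by
    have := Finset.card_filter_add_card_filter_not (s := (Finset.univ : Finset K))
      (fun l => act l x = x)
    rw [eq_sub_iff_add_eq, outDegree, ← Finset.card_univ, ← this]
    push_cast
    rfl
  have hsum : D = (Fintype.card K - outDegree act x) * (D / a) + g / a := by
    conv_lhs => rw [hpart]
    rw [Finset.sum_congr rfl fun l _ => hpiece l, Finset.sum_add_distrib, Finset.sum_ite_eq',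
      if_pos (Finset.mem_univ _), ← Finset.sum_filter, Finset.sum_const, nsmul_eq_mul, hcount]
  rw [eq_div_iff (hre _ hd)]
  field_simp at hsum
  rw [ha] at hsum
  linear_combination hsum

end JumpLaw

/-! ## The joint transform of the last times -/

section Transform

variable {K X : Type*} [Fintype K] [Nonempty K] (act : K → X → X) {m : ℕ} (c : Fin m → K)

open Classical in
/-- The transform of the vector of last times, restricted to the event that the successful rings
are those of the word. -/
def wordValue (ξ : Fin m → ℝ) : X → List K → ℂ
  | _, [] => 1
  | x, k :: w => (outDegree act x + ((∑ j, if c j ∈ k :: w then ξ j else 0 : ℝ) : ℂ) * Complex.I)⁻¹ *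
      wordValue ξ (act k x) w

theorem wave_mul_eq (y t : ℝ) : wave 1 (y * t) = wave y t := by simp [wave]

/-- The first jump time is part of the last time of every letter occurring in the word, so it
carries the total frequency `y` of these coordinates; `setIntegral_jumpClock` splits it off from the
rest. -/
theorem setIntegral_follows (ξ : Fin m → ℝ) {x : X} {w : List K} (hw : Complete act x w) :
    ∫ e in follows act x w, wave 1 (∑ j, ξ j * lastTime act x w e (c j)) ∂clockLaw K =
      wordValue act c ξ x w := by
  classical
  induction w generalizing x with
  | nil => simp [follows, lastTime, wordValue, wave_zero]
  | cons k w ih =>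
    set y : ℝ := ∑ j, if c j ∈ k :: w then ξ j else 0 with hy
    set G : (K × ℕ → ℝ) → ℂ := (follows act (act k x) w).indicator
      fun e => wave 1 (∑ j, ξ j * lastTime act (act k x) w e (c j)) with hG
    have hGm : Measurable G := by
      refine ((measurable_wave 1).comp ?_).indicator (measurableSet_follows act _ w)
      exact Finset.measurable_sum _ fun j _ => (measurable_lastTime act _ w _).const_mul _
    have hG1 : ∀ e, ‖G e‖ ≤ 1 := by
      intro e
      refine (norm_indicator_le_norm_self _ _).trans ?_
      rw [norm_wave]
    have hsum : ∀ e, ∑ j, ξ j * lastTime act x (k :: w) e (c j) =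
        y * jumpTime act x e +
          ∑ j, ξ j * lastTime act (act k x) w (afterJump act x e) (c j) := by
      intro e
      rw [hy, Finset.sum_mul, ← Finset.sum_add_distrib]
      refine Finset.sum_congr rfl fun j _ => ?_
      rw [lastTime]
      split_ifs with h
      · ring
      · rw [lastTime_of_notMem (fun h' => h (List.mem_cons_of_mem _ h'))]
        ring
    have hset : follows act x (k :: w) =
        {e | jumpClock act x e = k} ∩ afterJump act x ⁻¹' follows act (act k x) w := rfl
    have hS := measurable_afterJump act x (measurableSet_follows act (act k x) w)
    rw [wordValue, ← hy, ← ih hw.2,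
      ← integral_indicator (measurableSet_follows act _ w), ← hG, ← div_eq_inv_mul,
      ← setIntegral_jumpClock act hw.1 y hGm hG1, hset, ← setIntegral_indicator hS]
    congr 1
    ext e
    by_cases he : afterJump act x e ∈ follows act (act k x) w
    · rw [Set.indicator_of_mem (by exact he), hsum, wave_add, wave_mul_eq, hG,
        Set.indicator_of_mem he]
    · rw [Set.indicator_of_notMem (by exact he), hG, Set.indicator_of_notMem he, mul_zero]

/-! ### Almost every trajectory follows exactly one complete word; order cones. -/

variable {act}

/-- Frequency zero in `setIntegral_jumpClock`, applied to the indicator of `Sᶜ`, shows that null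
sets pull back to null sets on the event that `k` is the jump clock. -/
theorem ae_afterJump {x : X} {k : K} (hk : act k x ≠ x) {S : Set (K × ℕ → ℝ)}
    (hS : MeasurableSet S) (h : ∀ᵐ e ∂clockLaw K, e ∈ S) :
    ∀ᵐ e ∂clockLaw K, jumpClock act x e = k → afterJump act x e ∈ S := by
  have hI := setIntegral_jumpClock act hk 0 (G := Sᶜ.indicator fun _ => 1)
    (measurable_const.indicator hS.compl) (C := 1)
    fun e => (norm_indicator_le_norm_self _ _).trans (by simp)
  have h0 : clockLaw K Sᶜ = 0 := h
  have h1 : ∀ e, wave 0 (jumpTime act x e) * Sᶜ.indicator (fun _ => (1 : ℂ)) (afterJump act x e) =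
      (afterJump act x ⁻¹' Sᶜ).indicator (fun _ => 1) e := by
    intro e
    simp only [wave, zero_mul, Complex.ofReal_zero, neg_zero, Complex.exp_zero, one_mul]
    rfl
  simp only [h1] at hI
  rw [setIntegral_indicator (measurable_afterJump act x hS.compl),
    integral_indicator hS.compl] at hI
  simp only [integral_const, MeasurableSet.univ, measureReal_restrict_apply, Set.univ_inter,
    Complex.real_smul, mul_one] at hI
  rw [Measure.real, Measure.real, h0] at hI
  simp only [ENNReal.toReal_zero, Complex.ofReal_zero, zero_div, Complex.ofReal_eq_zero] at hI
  rw [ENNReal.toReal_eq_zero_iff, or_iff_left (measure_ne_top _ _)] at hI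
  rw [ae_iff]
  refine measure_mono_null (fun e he => ?_) hI
  simp only [Set.mem_ofPred_eq, Classical.not_imp] at he
  exact he

/-- At frequency zero each effective clock is the jump clock with probability `1 / outDegree`, and
these disjoint events exhaust the total mass. -/
theorem ae_jumpClock_ne {x : X} (hx : ¬ ∀ k, act k x = x) :
    ∀ᵐ e ∂clockLaw K, act (jumpClock act x e) x ≠ x := by
  classical
  push Not at hx
  have hd : outDegree act x ≠ 0 := by
    obtain ⟨k, hk⟩ := hx
    exact (Finset.card_pos.2 ⟨k, Finset.mem_filter.2 ⟨Finset.mem_univ _, hk⟩⟩).ne'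
  have hP : ∀ k, act k x ≠ x →
      (clockLaw K).real {e | jumpClock act x e = k} = (outDegree act x : ℝ)⁻¹ := by
    intro k hk
    have hI := setIntegral_jumpClock act hk 0 (G := fun _ => 1) measurable_const (C := 1) (by simp)
    simp [wave] at hI
    apply Complex.ofReal_injective
    rw [hI]
    push_cast
    rfl
  have hU : (clockLaw K).real
      (⋃ k ∈ Finset.univ.filter fun k => act k x ≠ x, {e | jumpClock act x e = k}) = 1 := by
    rw [measureReal_biUnion_finset]
    · rw [Finset.sum_congr rfl fun k hk => hP k (Finset.mem_filter.1 hk).2, Finset.sum_const,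
        nsmul_eq_mul]
      exact mul_inv_cancel₀ (Nat.cast_ne_zero.2 hd)
    · intro k _ l _ hkl
      exact Set.disjoint_left.2 fun e h h' => hkl (h.symm.trans h')
    · exact fun k _ => measurableSet_jumpClock act x k
  rw [Measure.real, ENNReal.toReal_eq_one_iff] at hU
  have hm : MeasurableSet
      (⋃ k ∈ Finset.univ.filter fun k => act k x ≠ x, {e | jumpClock act x e = k}) :=
    Finset.measurableSet_biUnion _ fun k _ => measurableSet_jumpClock act x k
  rw [prob_compl_eq_zero_iff hm |>.symm] at hU
  have := measure_eq_zero_iff_ae_notMem.1 hU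
  filter_upwards [this] with e he
  simpa using he

/-- Each success lowers `r`, so absorption comes after finitely many jumps; `ae_afterJump` carries
the induction hypothesis past the first one. -/
theorem ae_exists_follows (r : X → ℕ) (hr : ∀ k x, act k x ≠ x → r (act k x) < r x) (x : X) :
    ∀ᵐ e ∂clockLaw K, ∃ w, Complete act x w ∧ e ∈ follows act x w := by
  induction hn : r x using Nat.strong_induction_on generalizing x with
  | _ n ih =>
    by_cases hx : ∀ k, act k x = x
    · exact Filter.Eventually.of_forall fun e => ⟨[], hx, trivial⟩
    have hm : ∀ k, MeasurableSet {e | ∃ w, Complete act (act k x) w ∧ e ∈ follows act (act k x) w} := by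
      intro k
      have : {e : K × ℕ → ℝ | ∃ w, Complete act (act k x) w ∧ e ∈ follows act (act k x) w} =
          ⋃ w : {w // Complete act (act k x) w}, follows act (act k x) w.1 := by ext; simp
      rw [this]
      exact MeasurableSet.iUnion fun w => measurableSet_follows _ _ _
    have hall : ∀ᵐ e ∂clockLaw K, ∀ k, act k x ≠ x → jumpClock act x e = k →
        ∃ w, Complete act (act k x) w ∧ afterJump act x e ∈ follows act (act k x) w := by
      rw [ae_all_iff]
      intro k
      by_cases hk : act k x = x
      · exact Filter.Eventually.of_forall fun e h => absurd hk h
      · filter_upwards [ae_afterJump hk (hm k) (ih _ (hn ▸ hr k x hk) _ rfl)] with e he _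
        exact he
    filter_upwards [hall, ae_jumpClock_ne hx] with e h1 h2
    obtain ⟨w, hw, hf⟩ := h1 _ h2 rfl
    exact ⟨_ :: w, ⟨h2, hw⟩, rfl, hf⟩

variable (act) in
/-- The vector of the last times of successful rings of the clocks `c j`. -/
def lastTimes (x : X) (e : K → ℕ → ℝ) (j : Fin m) : ℝ := sSup (successTimes act x e (c j))

variable {T : Type*} [Fintype T] {word : T → List K}

/-- `word` enumerates the words of the complete trajectories from `x`. -/
structure Enumerates (act : K → X → X) (x : X) (word : T → List K) : Prop where
  injective : Function.Injective word
  complete_iff : ∀ w, Complete act x w ↔ ∃ t, word t = w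

omit [Fintype T] in
theorem Enumerates.ae_exists {x : X} (hT : Enumerates act x word) (r : X → ℕ)
    (hr : ∀ k x, act k x ≠ x → r (act k x) < r x) :
    ∀ᵐ e ∂clockLaw K, ∃ t, e ∈ follows act x (word t) ∧
      (∀ s, e ∈ follows act x (word s) → s = t) ∧
      lastTimes act c x (Function.curry e) = fun j => lastTime act x (word t) e (c j) := by
  filter_upwards [ae_exists_follows r hr x, ae_generic] with e ⟨w, hw, hf⟩ he
  obtain ⟨t, rfl⟩ := (hT.complete_iff w).1 hw
  refine ⟨t, hf, fun s hs => ?_, ?_⟩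
  · exact hT.injective (Complete.unique ((hT.complete_iff _).2 ⟨s, rfl⟩) hw hs hf)
  · funext j
    exact he.sSup_successTimes hw hf _

/-- Almost surely exactly one word is followed, so a single term survives. This yields both the
measurability of the vector of suprema and the splitting of integrals over words. -/
theorem Enumerates.ae_eq_sum {x : X} (hT : Enumerates act x word) (r : X → ℕ)
    (hr : ∀ k x, act k x ≠ x → r (act k x) < r x) {F : Type*} [AddCommMonoid F]
    (u : (Fin m → ℝ) → F) :
    (fun e => u (lastTimes act c x (Function.curry e))) =ᵐ[clockLaw K] fun e =>
      ∑ t, (follows act x (word t)).indicator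
        (fun e => u fun j => lastTime act x (word t) e (c j)) e := by
  filter_upwards [hT.ae_exists c r hr] with e ⟨t, h1, h2, h3⟩
  rw [Finset.sum_eq_single t, Set.indicator_of_mem h1, h3]
  · intro s _ hs
    exact Set.indicator_of_notMem (fun h => hs (h2 s h)) _
  · exact fun h => absurd (Finset.mem_univ t) h

theorem measurable_lastTime_vec (x : X) (w : List K) :
    Measurable fun e => fun j => lastTime act x w e (c j) :=
  measurable_pi_lambda _ fun _ => measurable_lastTime act x w _

theorem Enumerates.aemeasurable {x : X} (hT : Enumerates act x word) (r : X → ℕ)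
    (hr : ∀ k x, act k x ≠ x → r (act k x) < r x) :
    AEMeasurable (fun e => lastTimes act c x (Function.curry e)) (clockLaw K) := by
  refine AEMeasurable.congr (Measurable.aemeasurable ?_) (hT.ae_eq_sum c r hr id).symm
  exact Finset.measurable_sum _ fun t _ =>
    (measurable_lastTime_vec c x _).indicator (measurableSet_follows act x _)

theorem Enumerates.integral_eq {x : X} (hT : Enumerates act x word) (r : X → ℕ)
    (hr : ∀ k x, act k x ≠ x → r (act k x) < r x) {u : (Fin m → ℝ) → ℂ} (hu : Measurable u)
    (hu1 : ∀ v, ‖u v‖ ≤ 1) :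
    ∫ e, u (lastTimes act c x (Function.curry e)) ∂clockLaw K =
      ∑ t, ∫ e in follows act x (word t), u (fun j => lastTime act x (word t) e (c j))
        ∂clockLaw K := by
  rw [integral_congr_ae (hT.ae_eq_sum c r hr u), integral_finsetSum]
  · exact Finset.sum_congr rfl fun t _ => integral_indicator (measurableSet_follows act x _)
  · intro t _
    refine Integrable.indicator ?_ (measurableSet_follows act x _)
    exact Integrable.of_bound (hu.comp (measurable_lastTime_vec c x _)).aestronglyMeasurable 1
      (Filter.Eventually.of_forall fun e => hu1 _)

/-- The vectors whose entries are ordered like those of the permutation `σ`. -/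
def orderCone (σ : Equiv.Perm (Fin m)) : Set (Fin m → ℝ) :=
  {v | ∀ j k, σ j < σ k ↔ v j < v k}

theorem measurableSet_orderCone (σ : Equiv.Perm (Fin m)) : MeasurableSet (orderCone σ) := by
  unfold orderCone
  simp only [Set.ofPred_forall]
  refine MeasurableSet.iInter fun j => MeasurableSet.iInter fun k => ?_
  by_cases h : σ j < σ k
  · simpa [h] using measurableSet_lt (measurable_pi_apply j) (measurable_pi_apply k)
  · simpa [h] using measurableSet_le (measurable_pi_apply k) (measurable_pi_apply j)

/-- `τ * σ⁻¹` is an order automorphism of a finite chain, hence trivial. -/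
theorem perm_eq_of_lt_iff {σ τ : Equiv.Perm (Fin m)} (h : ∀ j k, σ j < σ k ↔ τ j < τ k) :
    σ = τ := by
  have hs : StrictMono (τ * σ⁻¹) := fun a b hab => by
    have := (h (σ⁻¹ a) (σ⁻¹ b)).1 (by simpa using hab)
    simpa using this
  let f : Fin m ≃o Fin m := StrictMono.orderIsoOfSurjective _ hs (τ * σ⁻¹).surjective
  have hf : f = OrderIso.refl _ := Subsingleton.elim _ _
  have : τ * σ⁻¹ = 1 := by
    ext j
    have := congrArg (fun g : Fin m ≃o Fin m => g j) hf
    simpa [f] using congrArg Fin.val this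
  exact (mul_inv_eq_one.1 this).symm

theorem orderPerm_eq_iff {v : Fin m → ℕ} (hv : Function.Injective v) (σ : Equiv.Perm (Fin m)) :
    orderPerm v = σ ↔ ∀ j k, σ j < σ k ↔ v j < v k := by
  constructor
  · rintro rfl
    exact orderPerm_lt_iff v hv
  · exact fun h => perm_eq_of_lt_iff fun j k => (orderPerm_lt_iff v hv j k).trans (h j k).symm

end Transform

/-! ## Equality in distribution in terms of the transforms -/

section Distribution

variable {m : ℕ}

open Classical in
/-- The random vector `V` has the transform `∑ t, val t`, and `ord` records the contribution of the
order cones. -/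
structure HasTransform {Ω T : Type*} [MeasurableSpace Ω] [Fintype T] (μ : Measure Ω)
    (V : Ω → Fin m → ℝ) (ord : T → Equiv.Perm (Fin m)) (val : T → (Fin m → ℝ) → ℂ) : Prop where
  aemeasurable : AEMeasurable V μ
  integral : ∀ ξ, ∫ ω, wave 1 (∑ j, ξ j * V ω j) ∂μ = ∑ t, val t ξ
  integral_cone : ∀ σ ξ, ∫ ω, (orderCone σ).indicator (fun v => wave 1 (∑ j, ξ j * v j)) (V ω) ∂μ =
    ∑ t, if ord t = σ then val t ξ else 0

theorem measurable_wave_sum (ξ : Fin m → ℝ) :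
    Measurable fun v : Fin m → ℝ => wave 1 (∑ j, ξ j * v j) :=
  (measurable_wave 1).comp
    (Finset.measurable_sum _ fun j _ => (measurable_pi_apply j).const_mul _)

-- Forward, the law determines the integral over every cone. Backward, summing over `σ` recovers the
-- full transform, and the characteristic function determines the law.
open Classical in
theorem HasTransform.identDistrib_iff {Ω Ω' T T' : Type*} [MeasurableSpace Ω] [MeasurableSpace Ω']
    [Fintype T] [Fintype T'] {μ : Measure Ω} {μ' : Measure Ω'} [IsProbabilityMeasure μ]
    [IsProbabilityMeasure μ'] {V : Ω → Fin m → ℝ} {V' : Ω' → Fin m → ℝ}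
    {ord : T → Equiv.Perm (Fin m)} {val : T → (Fin m → ℝ) → ℂ}
    {ord' : T' → Equiv.Perm (Fin m)} {val' : T' → (Fin m → ℝ) → ℂ}
    (h : HasTransform μ V ord val) (h' : HasTransform μ' V' ord' val') :
    IdentDistrib V V' μ μ' ↔ ∀ σ ξ, (∑ t, if ord t = σ then val t ξ else 0) =
      ∑ t, if ord' t = σ then val' t ξ else 0 := by
  constructor
  · intro hV σ ξ
    rw [← h.integral_cone, ← h'.integral_cone]
    exact (hV.comp ((measurable_wave_sum ξ).indicator (measurableSet_orderCone σ))).integral_eq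
  · intro heq
    refine ⟨h.aemeasurable, h'.aemeasurable, ?_⟩
    have := Measure.isProbabilityMeasure_map h.aemeasurable
    have := Measure.isProbabilityMeasure_map h'.aemeasurable
    refine Measure.ext_of_charFunDual ?_
    ext L
    -- The sign compensates the minus in the definition of `wave`.
    set ξ : Fin m → ℝ := fun j => -L (Pi.single j 1) with hξ
    have hL : ∀ v : Fin m → ℝ, Complex.exp (L v * Complex.I) = wave 1 (∑ j, ξ j * v j) := by
      intro v
      have : L v = -∑ j, ξ j * v j := by
        conv_lhs => rw [pi_eq_sum_univ' v]
        rw [map_sum, ← Finset.sum_neg_distrib]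
        refine Finset.sum_congr rfl fun j _ => ?_
        have hv : (Pi.single j 1 : Fin m → ℝ) = fun i => if i = j then 1 else 0 := by
          funext i; simp [Pi.single_apply]
        simp only [hξ, hv, map_smul, smul_eq_mul]
        ring
      rw [this, wave]
      congr 1
      push_cast
      ring
    have hsum : ∀ ξ, ∑ t, val t ξ = ∑ t, val' t ξ := by
      intro ξ
      have e1 : ∑ t, val t ξ = ∑ σ, ∑ t, if ord t = σ then val t ξ else 0 := by
        rw [Finset.sum_comm]; simp
      have e2 : ∑ t, val' t ξ = ∑ σ, ∑ t, if ord' t = σ then val' t ξ else 0 := by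
        rw [Finset.sum_comm]; simp
      rw [e1, e2]
      exact Finset.sum_congr rfl fun σ _ => heq σ ξ
    rw [charFunDual_apply, charFunDual_apply]
    simp only [hL]
    rw [integral_map h.aemeasurable (measurable_wave_sum ξ).aestronglyMeasurable,
      integral_map h'.aemeasurable (measurable_wave_sum ξ).aestronglyMeasurable,
      h.integral, h'.integral, hsum]

theorem IsPoissonClocks.map_eq_clockLaw {K Ω : Type*} [Fintype K] [MeasurableSpace Ω]
    {μ : Measure Ω} {E : K → ℕ → Ω → ℝ} (hE : IsPoissonClocks μ E) :
    μ.map (fun ω (p : K × ℕ) => E p.1 p.2 ω) = clockLaw K := by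
  have := hE.indep.isProbabilityMeasure
  refine (hE.indep.map_fun_eq_infinitePi_map fun p : K × ℕ => hE.measurable p.1 p.2).trans ?_
  simp only [hE.law]
  rfl

theorem IsPoissonClocks.hasTransform {K X T Ω : Type*} [Fintype K] [Nonempty K] [Fintype T]
    [MeasurableSpace Ω] {μ : Measure Ω} {E : K → ℕ → Ω → ℝ} (hE : IsPoissonClocks μ E)
    {act : K → X → X} {x : X} {word : T → List K} (hT : Enumerates act x word) (r : X → ℕ)
    (hr : ∀ k x, act k x ≠ x → r (act k x) < r x) (c : Fin m → K)
    (hc : ∀ t, Function.Injective fun j => lastIdx (word t) (c j)) :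
    HasTransform μ (fun ω => lastTimes act c x fun k i => E k i ω)
      (fun t => orderPerm fun j => lastIdx (word t) (c j))
      (fun t ξ => wordValue act c ξ x (word t)) := by
  classical
  have hEm : Measurable fun ω (p : K × ℕ) => E p.1 p.2 ω :=
    measurable_pi_lambda _ fun p => hE.measurable p.1 p.2
  have hV := hT.aemeasurable c r hr
  have hint : ∀ u : (Fin m → ℝ) → ℂ, Measurable u → (∀ v, ‖u v‖ ≤ 1) →
      ∫ ω, u (lastTimes act c x fun k i => E k i ω) ∂μ =
      ∑ t, ∫ e in follows act x (word t), u (fun j => lastTime act x (word t) e (c j))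
        ∂clockLaw K := by
    intro u hu hu1
    rw [← hT.integral_eq c r hr hu hu1, ← hE.map_eq_clockLaw,
      integral_map hEm.aemeasurable]
    · rfl
    · rw [hE.map_eq_clockLaw]
      exact (hu.comp_aemeasurable hV).aestronglyMeasurable
  refine ⟨?_, fun ξ => ?_, fun σ ξ => ?_⟩
  · rw [← hE.map_eq_clockLaw] at hV
    exact hV.comp_measurable hEm
  · rw [hint _ (measurable_wave_sum ξ) fun v => (norm_wave _ _).le]
    exact Finset.sum_congr rfl fun t _ =>
      setIntegral_follows act c ξ ((hT.complete_iff _).2 ⟨t, rfl⟩)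
  · rw [hint _ ((measurable_wave_sum ξ).indicator (measurableSet_orderCone σ)) fun v =>
      (norm_indicator_le_norm_self _ _).trans (norm_wave _ _).le]
    refine Finset.sum_congr rfl fun t _ => ?_
    -- For a given word, the vector lies in the cone either for every generic `e` or for none.
    have hcone : ∀ᵐ e ∂clockLaw K, (fun j => lastTime act x (word t) e (c j)) ∈ orderCone σ ↔
        orderPerm (fun j => lastIdx (word t) (c j)) = σ := by
      filter_upwards [ae_generic] with e he
      rw [orderPerm_eq_iff (hc t)]
      exact forall₂_congr fun j k => by rw [he.lastTime_lt_iff]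
    split_ifs with hσ
    · rw [← setIntegral_follows act c ξ ((hT.complete_iff _).2 ⟨t, rfl⟩)]
      refine integral_congr_ae (ae_restrict_of_ae ?_)
      filter_upwards [hcone] with e he
      rw [Set.indicator_of_mem (he.2 hσ)]
    · rw [← integral_zero (K × ℕ → ℝ) ℂ]
      refine integral_congr_ae (ae_restrict_of_ae ?_)
      filter_upwards [hcone] with e he
      rw [Set.indicator_of_notMem (fun h => hσ (he.1 h))]

end Distribution

/-! ## Rational functions and their values -/

section Rational

variable {m : ℕ}

/-- The points with purely imaginary coordinates. -/
def imagPoints (m : ℕ) : Set (Fin m → ℂ) := Set.pi Set.univ fun _ => {z | z.re = 0}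

/-- A polynomial is determined by its values on a product of infinite sets, here copies of the
imaginary axis. -/
theorem polynomial_eq_of_imagPoints {p q : MvPolynomial (Fin m) ℂ}
    (h : ∀ a ∈ imagPoints m, MvPolynomial.eval a p = MvPolynomial.eval a q) : p = q := by
  refine MvPolynomial.funext_set (fun _ => {z | z.re = 0}) (fun _ => ?_) h
  refine Set.infinite_of_injective_forall_mem (f := fun y : ℝ => (y : ℂ) * Complex.I) ?_ ?_
  · intro y z hyz
    simpa using hyz
  · intro y
    simp

/-- The rational function `F` is defined at all the imaginary points, with values `φ`. -/
def HasValues (F : RatFun m) (φ : (Fin m → ℂ) → ℂ) : Prop :=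
  ∃ A D : MvPolynomial (Fin m) ℂ,
    F * algebraMap _ (RatFun m) D = algebraMap _ (RatFun m) A ∧
    ∀ a ∈ imagPoints m, MvPolynomial.eval a D ≠ 0 ∧
      φ a * MvPolynomial.eval a D = MvPolynomial.eval a A

theorem HasValues.polynomial (p : MvPolynomial (Fin m) ℂ) :
    HasValues (algebraMap _ (RatFun m) p) fun a => MvPolynomial.eval a p :=
  ⟨p, 1, by simp, fun a _ => by simp⟩

theorem HasValues.add {F G : RatFun m} {φ ψ : (Fin m → ℂ) → ℂ} (hF : HasValues F φ)
    (hG : HasValues G ψ) : HasValues (F + G) fun a => φ a + ψ a := by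
  obtain ⟨A, D, h1, h2⟩ := hF
  obtain ⟨B, E, h3, h4⟩ := hG
  refine ⟨A * E + B * D, D * E, ?_, fun a ha => ⟨?_, ?_⟩⟩
  · simp only [map_mul, map_add, ← h1, ← h3]
    ring
  · simpa using ⟨(h2 a ha).1, (h4 a ha).1⟩
  · simp only [map_mul, map_add, ← (h2 a ha).2, ← (h4 a ha).2]
    ring

theorem HasValues.mul {F G : RatFun m} {φ ψ : (Fin m → ℂ) → ℂ} (hF : HasValues F φ)
    (hG : HasValues G ψ) : HasValues (F * G) fun a => φ a * ψ a := by
  obtain ⟨A, D, h1, h2⟩ := hF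
  obtain ⟨B, E, h3, h4⟩ := hG
  refine ⟨A * B, D * E, ?_, fun a ha => ⟨?_, ?_⟩⟩
  · simp only [map_mul, ← h1, ← h3]
    ring
  · simpa using ⟨(h2 a ha).1, (h4 a ha).1⟩
  · simp only [map_mul, ← (h2 a ha).2, ← (h4 a ha).2]
    ring

theorem HasValues.sum {ι : Type*} {F : ι → RatFun m} {φ : ι → (Fin m → ℂ) → ℂ} (s : Finset ι)
    (h : ∀ i ∈ s, HasValues (F i) (φ i)) : HasValues (∑ i ∈ s, F i) fun a => ∑ i ∈ s, φ i a := by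
  classical
  induction s using Finset.induction_on with
  | empty => simpa using HasValues.polynomial (0 : MvPolynomial (Fin m) ℂ)
  | insert i s hi ih =>
    simp only [Finset.sum_insert hi]
    exact (h i (Finset.mem_insert_self _ _)).add
      (ih fun j hj => h j (Finset.mem_insert_of_mem hj))

theorem HasValues.prod {ι : Type*} {F : ι → RatFun m} {φ : ι → (Fin m → ℂ) → ℂ} (s : Finset ι)
    (h : ∀ i ∈ s, HasValues (F i) (φ i)) : HasValues (∏ i ∈ s, F i) fun a => ∏ i ∈ s, φ i a := by
  classical
  induction s using Finset.induction_on with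
  | empty => simpa using HasValues.polynomial (1 : MvPolynomial (Fin m) ℂ)
  | insert i s hi ih =>
    simp only [Finset.prod_insert hi]
    exact (h i (Finset.mem_insert_self _ _)).mul
      (ih fun j hj => h j (Finset.mem_insert_of_mem hj))

theorem ne_zero_of_eval_ne_zero {D : MvPolynomial (Fin m) ℂ}
    (h : ∀ a ∈ imagPoints m, MvPolynomial.eval a D ≠ 0) : algebraMap _ (RatFun m) D ≠ 0 := by
  intro h0
  rw [map_eq_zero_iff _ (IsFractionRing.injective (MvPolynomial (Fin m) ℂ) (RatFun m))] at h0
  exact h 0 (fun _ _ => by simp) (by simp [h0])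

theorem HasValues.inv_linear (k : Fin m) {d : ℕ} (hd : 0 < d) :
    HasValues (algebraMap (MvPolynomial (Fin m) ℂ) (RatFun m) (MvPolynomial.X k) +
      (d : RatFun m))⁻¹ fun a => (a k + d)⁻¹ := by
  have hne : ∀ a ∈ imagPoints m, a k + d ≠ 0 := by
    intro a ha h
    have h1 : (a k).re = 0 := ha k trivial
    have := congrArg Complex.re h
    simp [h1] at this
    omega
  have hmap : algebraMap (MvPolynomial (Fin m) ℂ) (RatFun m) (MvPolynomial.X k) + (d : RatFun m) =
      algebraMap _ (RatFun m) (MvPolynomial.X k + (d : MvPolynomial (Fin m) ℂ)) := by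
    rw [map_add, map_natCast]
  refine ⟨1, MvPolynomial.X k + (d : MvPolynomial (Fin m) ℂ), ?_, fun a ha => ⟨?_, ?_⟩⟩
  · rw [hmap, map_one, inv_mul_cancel₀]
    exact ne_zero_of_eval_ne_zero fun a ha => by simpa using hne a ha
  · simpa using hne a ha
  · simpa using inv_mul_cancel₀ (hne a ha)

/-- Cross-multiplication reduces this to a polynomial identity; the denominators vanish at no
imaginary point, so they are nonzero. -/
theorem HasValues.eq_iff {F G : RatFun m} {φ ψ : (Fin m → ℂ) → ℂ} (hF : HasValues F φ)
    (hG : HasValues G ψ) : F = G ↔ ∀ a ∈ imagPoints m, φ a = ψ a := by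
  obtain ⟨A, D, h1, h2⟩ := hF
  obtain ⟨B, E, h3, h4⟩ := hG
  have hD := ne_zero_of_eval_ne_zero fun a ha => (h2 a ha).1
  have hE := ne_zero_of_eval_ne_zero fun a ha => (h4 a ha).1
  constructor
  · rintro rfl a ha
    have hAB : A * E = B * D := by
      apply IsFractionRing.injective (MvPolynomial (Fin m) ℂ) (RatFun m)
      rw [map_mul, map_mul, ← h1, ← h3]
      ring
    have := congrArg (MvPolynomial.eval a) hAB
    rw [map_mul, map_mul, ← (h2 a ha).2, ← (h4 a ha).2] at this
    refine mul_right_cancel₀ (mul_ne_zero (h2 a ha).1 (h4 a ha).1) ?_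
    linear_combination this
  · intro h
    have hAB : A * E = B * D := by
      refine polynomial_eq_of_imagPoints fun a ha => ?_
      rw [map_mul, map_mul, ← (h2 a ha).2, ← (h4 a ha).2, h a ha]
      ring
    have := congrArg (algebraMap _ (RatFun m)) hAB
    rw [map_mul, map_mul, ← h1, ← h3] at this
    refine mul_right_cancel₀ (mul_ne_zero hD hE) ?_
    linear_combination this

end Rational

/-! ## Generating factors -/

section Factor

variable {m : ℕ}

theorem rearranged_succ (v : Fin m → ℕ) (k : Fin m) : rearranged v (k + 1) = v (Tuple.sort v k) := by
  simp [rearranged, orderPerm]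

theorem rearranged_orderPerm (v : Fin m → ℕ) (i : Fin m) :
    rearranged v (orderPerm v i + 1) = v i := by
  rw [rearranged_succ]
  simp [orderPerm]

theorem rearranged_mono (v : Fin m → ℕ) {a b : ℕ} (hab : a ≤ b) (hb : b ≤ m) :
    rearranged v a ≤ rearranged v b := by
  cases a with
  | zero => simp [rearranged]
  | succ a =>
    obtain ⟨b, rfl⟩ : ∃ b', b = b' + 1 := ⟨b - 1, by omega⟩
    have h1 := rearranged_succ v ⟨a, by omega⟩
    have h2 := rearranged_succ v ⟨b, by omega⟩
    simp only at h1 h2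
    rw [h1, h2]
    exact Tuple.monotone_sort v (by simpa using hab)

theorem rearranged_eq_of_max {v : Fin m → ℕ} {N : ℕ} (hle : ∀ k, v k ≤ N) (hex : ∃ k, v k = N) :
    rearranged v m = N := by
  obtain ⟨k, hk⟩ := hex
  have hm : 0 < m := k.pos
  refine le_antisymm ?_ ?_
  · have := rearranged_succ v ⟨m - 1, by omega⟩
    simp only [Nat.sub_add_cancel hm] at this
    rw [this]
    exact hle _
  · rw [← hk, ← rearranged_orderPerm v k]
    exact rearranged_mono v (orderPerm v k).isLt le_rfl

/-- The value of the generating factor at a point. -/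
def factorValue (v : Fin m → ℕ) (d : ℕ → ℕ) (a : Fin m → ℂ) : ℂ :=
  ∏ k : Fin m, ∏ j ∈ Finset.Ico (rearranged v k) (rearranged v (k + 1)), (a k + d j)⁻¹

theorem hasValues_generatingFactor {v : Fin m → ℕ} {d : ℕ → ℕ} {N : ℕ} (hle : ∀ k, v k ≤ N)
    (hd : ∀ j < N, 0 < d j) : HasValues (generatingFactor v d) (factorValue v d) := by
  refine HasValues.prod _ fun k _ => HasValues.prod _ fun j hj => HasValues.inv_linear k (hd j ?_)
  have := (Finset.mem_Ico.1 hj).2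
  rw [rearranged_succ] at this
  exact this.trans_le (hle _)

theorem prod_blocks (v : Fin m → ℕ) (F : ℕ → ℂ) :
    ∏ k : Fin m, ∏ j ∈ Finset.Ico (rearranged v k) (rearranged v (k + 1)), F j =
      ∏ j ∈ Finset.range (rearranged v m), F j := by
  rw [Fin.prod_univ_eq_prod_range
    (fun k => ∏ j ∈ Finset.Ico (rearranged v k) (rearranged v (k + 1)), F j) m]
  have : ∀ n ≤ m, ∏ k ∈ Finset.range n,
      ∏ j ∈ Finset.Ico (rearranged v k) (rearranged v (k + 1)), F j =
      ∏ j ∈ Finset.range (rearranged v n), F j := by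
    intro n hn
    induction n with
    | zero => simp [rearranged]
    | succ n ih =>
      rw [Finset.prod_range_succ, ih (by omega), Finset.prod_range_mul_prod_Ico]
      exact rearranged_mono v (Nat.le_succ n) hn
  exact this m le_rfl

/-- The product over the steps `j < N` of the factors belonging to the last times `v` and the
frequencies `ξ`. -/
def stepValue (v : Fin m → ℕ) (d : ℕ → ℕ) (N : ℕ) (ξ : Fin m → ℝ) : ℂ :=
  ∏ j ∈ Finset.range N, (d j + ((∑ i, if j < v i then ξ i else 0 : ℝ) : ℂ) * Complex.I)⁻¹

/-- The point at which the generating factor of a vector ordered like `σ` is the transform at the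
frequencies `ξ`. -/
def imagPoint (σ : Equiv.Perm (Fin m)) (ξ : Fin m → ℝ) (k : Fin m) : ℂ :=
  ((∑ i, if k ≤ σ i then ξ i else 0 : ℝ) : ℂ) * Complex.I

theorem imagPoint_mem (σ : Equiv.Perm (Fin m)) (ξ : Fin m → ℝ) :
    imagPoint σ ξ ∈ imagPoints m := by
  intro k _
  simp [imagPoint]

theorem exists_imagPoint (σ : Equiv.Perm (Fin m)) {a : Fin m → ℂ} (ha : a ∈ imagPoints m) :
    ∃ ξ, imagPoint σ ξ = a := by
  -- `Y` lists the imaginary parts of `a` and vanishes from `m` on, so the tail sums of its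
  -- consecutive differences telescope to `Y k`.
  let Y : ℕ → ℝ := fun n => if h : n < m then (a ⟨n, h⟩).im else 0
  refine ⟨fun i => Y (σ i) - Y (σ i + 1), ?_⟩
  funext k
  have hsum : (∑ i, if k ≤ σ i then Y (σ i) - Y (σ i + 1) else 0) = (a k).im := by
    rw [Equiv.sum_comp σ (fun l : Fin m => if k ≤ l then Y l - Y (l + 1) else 0)]
    have h1 : ∀ l : Fin m, (if k ≤ l then Y l - Y (l + 1) else 0) =
        (fun n : ℕ => if (k : ℕ) ≤ n then Y n - Y (n + 1) else 0) l := fun l => by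
      simp only [Fin.le_def]
    rw [Finset.sum_congr rfl fun l _ => h1 l, Fin.sum_univ_eq_sum_range
      (fun n : ℕ => if (k : ℕ) ≤ n then Y n - Y (n + 1) else 0), ← Finset.sum_filter]
    have h2 : (Finset.range m).filter (fun n => (k : ℕ) ≤ n) = Finset.Ico (k : ℕ) m := by
      ext n
      simp only [Finset.mem_filter, Finset.mem_range, Finset.mem_Ico]
      omega
    have h3 := Finset.sum_Ico_sub Y k.isLt.le
    have h4 : ∑ n ∈ Finset.Ico (k : ℕ) m, (Y n - Y (n + 1)) = Y k - Y m := by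
      rw [← neg_sub (Y m), ← h3, ← Finset.sum_neg_distrib]
      exact Finset.sum_congr rfl fun _ _ => (neg_sub _ _).symm
    rw [h2, h4]
    simp [Y]
  have h0 : (a k).re = 0 := ha k trivial
  rw [imagPoint, hsum]
  exact Complex.ext (by simp [h0]) (by simp)

/-- For a step `j` in block `k`, `j < v i` holds exactly when the rank of `v i` is at least `k`, so
the frequency is constant on the block. `hex` makes the blocks fill `range N`. -/
theorem factorValue_imagPoint {v : Fin m → ℕ} (d : ℕ → ℕ) {N : ℕ} (hle : ∀ k, v k ≤ N)
    (hex : ∃ k, v k = N) (ξ : Fin m → ℝ) :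
    factorValue v d (imagPoint (orderPerm v) ξ) = stepValue v d N ξ := by
  rw [factorValue, stepValue, ← rearranged_eq_of_max hle hex, ← prod_blocks]
  refine Finset.prod_congr rfl fun k _ => Finset.prod_congr rfl fun j hj => ?_
  rw [imagPoint, add_comm]
  congr 4
  refine Finset.sum_congr rfl fun i _ => if_congr ?_ rfl rfl
  rw [Finset.mem_Ico] at hj
  rw [← rearranged_orderPerm v i]
  constructor
  · intro h
    refine hj.2.trans_le (rearranged_mono v ?_ (orderPerm v i).isLt)
    exact Nat.succ_le_succ h
  · intro h
    by_contra hlt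
    rw [not_le] at hlt
    exact absurd (h.trans_le (rearranged_mono v (a := orderPerm v i + 1) (b := k) hlt k.isLt.le))
      (not_lt.2 hj.1)

theorem hasValues_sum {T : Type*} [Fintype T] {v : T → Fin m → ℕ} {d : T → ℕ → ℕ} {N : ℕ}
    (hle : ∀ t k, v t k ≤ N) (hd : ∀ t, ∀ j < N, 0 < d t j) (σ : Equiv.Perm (Fin m)) :
    HasValues (∑ t, if orderPerm (v t) = σ then generatingFactor (v t) (d t) else 0)
      fun a => ∑ t, if orderPerm (v t) = σ then factorValue (v t) (d t) a else 0 := by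
  refine HasValues.sum _ fun t _ => ?_
  split_ifs
  · exact hasValues_generatingFactor (hle t) (hd t)
  · simpa using HasValues.polynomial (0 : MvPolynomial (Fin m) ℂ)

theorem sum_factorValue_imagPoint {T : Type*} [Fintype T] {v : T → Fin m → ℕ} (d : T → ℕ → ℕ)
    {N : ℕ} (hle : ∀ t k, v t k ≤ N) (hex : ∀ t, ∃ k, v t k = N) (σ : Equiv.Perm (Fin m))
    (ξ : Fin m → ℝ) :
    (∑ t, if orderPerm (v t) = σ then factorValue (v t) (d t) (imagPoint σ ξ) else 0) =
      ∑ t, if orderPerm (v t) = σ then stepValue (v t) (d t) N ξ else 0 := by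
  refine Finset.sum_congr rfl fun t _ => ?_
  split_ifs with h
  · rw [← h, factorValue_imagPoint _ (hle t) (hex t)]
  · rfl

theorem sum_single_apply {T : Type*} [Fintype T] (ord : T → Equiv.Perm (Fin m))
    (F : T → RatFun m) (σ : Equiv.Perm (Fin m)) :
    (∑ t, Finsupp.single (ord t) (F t) : Equiv.Perm (Fin m) →₀ RatFun m) σ =
      ∑ t, if ord t = σ then F t else 0 := by
  simp only [Finsupp.finsetSum_apply, Finsupp.single_apply]

/-- The substitution `imagPoint σ` depends on the permutation only, so it can be made at once in all
terms of the coefficient at `σ`, on both sides. The lengths `N` and `N'` need not be compared. -/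
theorem sum_single_eq_iff {T T' : Type*} [Fintype T] [Fintype T'] {v : T → Fin m → ℕ}
    {d : T → ℕ → ℕ} {N : ℕ} {v' : T' → Fin m → ℕ} {d' : T' → ℕ → ℕ} {N' : ℕ}
    (hle : ∀ t k, v t k ≤ N) (hex : ∀ t, ∃ k, v t k = N) (hd : ∀ t, ∀ j < N, 0 < d t j)
    (hle' : ∀ t k, v' t k ≤ N') (hex' : ∀ t, ∃ k, v' t k = N') (hd' : ∀ t, ∀ j < N', 0 < d' t j) :
    (∑ t, Finsupp.single (orderPerm (v t)) (generatingFactor (v t) (d t)) :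
        Equiv.Perm (Fin m) →₀ RatFun m) =
      ∑ t, Finsupp.single (orderPerm (v' t)) (generatingFactor (v' t) (d' t)) ↔
    ∀ σ ξ, (∑ t, if orderPerm (v t) = σ then stepValue (v t) (d t) N ξ else 0) =
      ∑ t, if orderPerm (v' t) = σ then stepValue (v' t) (d' t) N' ξ else 0 := by
  rw [Finsupp.ext_iff]
  refine forall_congr' fun σ => ?_
  rw [sum_single_apply, sum_single_apply,
    (hasValues_sum hle hd σ).eq_iff (hasValues_sum hle' hd' σ)]
  constructor
  · intro h ξ
    rw [← sum_factorValue_imagPoint d hle hex, ← sum_factorValue_imagPoint d' hle' hex']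
    exact h _ (imagPoint_mem σ ξ)
  · intro h a ha
    obtain ⟨ξ, rfl⟩ := exists_imagPoint σ ha
    rw [sum_factorValue_imagPoint d hle hex, sum_factorValue_imagPoint d' hle' hex']
    exact h ξ

end Factor

/-! ### Word transforms as products over steps. -/

section Words

variable {K X : Type*} [Fintype K] [Nonempty K] (act : K → X → X) {m : ℕ} (c : Fin m → K)

omit [Nonempty K] in
theorem wordValue_eq_stepValue (ξ : Fin m → ℝ) (x : X) (w : List K) :
    wordValue act c ξ x w = stepValue (fun i => lastIdx w (c i))
      (fun j => outDegree act ((w.take j).foldl (fun y k => act k y) x)) w.length ξ := by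
  classical
  induction w generalizing x with
  | nil => simp [wordValue, stepValue]
  | cons k w ih =>
    rw [wordValue, ih, stepValue, stepValue, List.length_cons, Finset.prod_range_succ', mul_comm]
    congr 1
    · refine Finset.prod_congr rfl fun j _ => ?_
      rw [List.take_succ_cons, List.foldl_cons]
      congr 4
      refine Finset.sum_congr rfl fun i _ => if_congr ?_ rfl rfl
      rw [lt_lastIdx_iff, lt_lastIdx_iff, List.drop_succ_cons]
    · rw [List.take_zero, List.foldl_nil]
      congr 4
      refine Finset.sum_congr rfl fun i _ => if_congr ?_ rfl rfl
      rw [lt_lastIdx_iff, List.drop_zero]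

omit [Nonempty K] in
theorem Complete.outDegree_pos {x : X} {w : List K} (hw : Complete act x w) {j : ℕ}
    (hj : j < w.length) : 0 < outDegree act ((w.take j).foldl (fun y k => act k y) x) := by
  induction w generalizing x j with
  | nil => simp at hj
  | cons k w ih =>
    cases j with
    | zero =>
      classical
      exact Finset.card_pos.2 ⟨k, Finset.mem_filter.2 ⟨Finset.mem_univ _, hw.1⟩⟩
    | succ j => exact ih hw.2 (by simpa using hj)

omit [Fintype K] [Nonempty K] in
theorem lastIdx_le_length (w : List K) (l : K) : lastIdx w l ≤ w.length := by
  by_contra h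
  rw [not_le, lt_lastIdx_iff] at h
  simp at h

end Words

/-! ## Positions in words -/

section LastIdx

variable {K : Type*}

theorem mem_drop_ofFn {N : ℕ} (s : Fin N → K) (j : ℕ) (k : K) :
    k ∈ (List.ofFn s).drop j ↔ ∃ i : Fin N, j ≤ i ∧ s i = k := by
  rw [List.mem_iff_getElem]
  simp only [List.getElem_drop, List.getElem_ofFn, List.length_drop, List.length_ofFn]
  constructor
  · rintro ⟨i, hi, rfl⟩
    exact ⟨⟨j + i, by omega⟩, by simp, rfl⟩
  · rintro ⟨i, hi, rfl⟩
    refine ⟨i - j, by omega, ?_⟩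
    congr 1
    ext
    simp
    omega

theorem mem_take_ofFn {N : ℕ} (s : Fin N → K) (j : ℕ) (k : K) :
    k ∈ (List.ofFn s).take j ↔ ∃ i : Fin N, (i : ℕ) < j ∧ s i = k := by
  rw [List.mem_iff_getElem]
  simp only [List.getElem_take, List.getElem_ofFn, List.length_take, List.length_ofFn]
  constructor
  · rintro ⟨i, hi, rfl⟩
    exact ⟨⟨i, by omega⟩, by simp only; omega, rfl⟩
  · rintro ⟨i, hi, rfl⟩
    exact ⟨i, by omega, rfl⟩

theorem lt_lastIdx_ofFn_iff {N : ℕ} (s : Fin N → K) (j : ℕ) (k : K) :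
    j < lastIdx (List.ofFn s) k ↔ ∃ i : Fin N, j ≤ i ∧ s i = k := by
  rw [lt_lastIdx_iff, mem_drop_ofFn]

theorem lastIdx_ofFn_last {N : ℕ} (s : Fin N → K) {i : Fin N} (hi : (i : ℕ) + 1 = N) :
    lastIdx (List.ofFn s) (s i) = N := by
  refine le_antisymm ((lastIdx_le_length _ _).trans (List.length_ofFn).le) ?_
  have := (lt_lastIdx_ofFn_iff s i (s i)).2 ⟨i, le_rfl, rfl⟩
  omega

/-- A position holds one letter; `hk` excludes that both letters are absent and share the default
zero. -/
theorem eq_of_lastIdx_eq {w : List K} {k l : K} (hk : k ∈ w) (h : lastIdx w k = lastIdx w l) :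
    k = l := by
  induction w with
  | nil => simp at hk
  | cons a w ih =>
    rw [lastIdx, if_pos hk, lastIdx] at h
    split_ifs at h with hl
    · rw [add_left_inj] at h
      have h0 : k ∈ w ↔ l ∈ w := by
        rw [← List.drop_zero (l := w), ← lt_lastIdx_iff, ← lt_lastIdx_iff, h]
      by_cases hkw : k ∈ w
      · exact ih hkw h
      · rw [(List.mem_cons.1 hk).resolve_right hkw,
          (List.mem_cons.1 hl).resolve_right (fun h' => hkw (h0.2 h'))]

theorem exists_ofFn_eq {w : List K} {N : ℕ} (h : w.length = N) :
    ∃ s : Fin N → K, List.ofFn s = w := by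
  subst h
  exact ⟨w.get, List.ofFn_get w⟩

end LastIdx

/-! ## Sorting networks as complete words -/

section Networks

variable {n : ℕ}

theorem swapAttempt_ne_iff (k : Fin (n - 1)) (ν : Equiv.Perm (Fin n)) :
    swapAttempt k ν ≠ ν ↔ ν (leftPos k) < ν (rightPos k) := by
  unfold swapAttempt
  split_ifs with h
  · refine iff_of_true (fun h' => ?_) h
    rw [mul_eq_left, adjSwap, Equiv.swap_eq_one_iff] at h'
    rw [h'] at h
    exact lt_irrefl _ h
  · exact iff_of_false (fun h' => h' rfl) h

theorem swapAttempt_of_ne {k : Fin (n - 1)} {ν : Equiv.Perm (Fin n)} (h : swapAttempt k ν ≠ ν) :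
    swapAttempt k ν = ν * adjSwap k :=
  if_pos ((swapAttempt_ne_iff k ν).1 h)

/-- The pairs of positions in increasing order whose labels are in increasing order. -/
def ascendingPairs (ν : Equiv.Perm (Fin n)) : Finset (Fin n × Fin n) :=
  Finset.univ.filter fun p => p.1 < p.2 ∧ ν p.1 < ν p.2

theorem mem_ascendingPairs {ν : Equiv.Perm (Fin n)} {i j : Fin n} :
    (i, j) ∈ ascendingPairs ν ↔ i < j ∧ ν i < ν j := by
  simp [ascendingPairs]

theorem adjSwap_lt {k : Fin (n - 1)} {i j : Fin n} (hij : i < j)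
    (hne : (i, j) ≠ (leftPos k, rightPos k)) : adjSwap k i < adjSwap k j := by
  have hl : (leftPos k : ℕ) = k := rfl
  have hr : (rightPos k : ℕ) = k + 1 := rfl
  rw [Ne, Prod.mk.injEq, Fin.ext_iff, Fin.ext_iff, hl, hr] at hne
  rw [adjSwap, Equiv.swap_apply_def, Equiv.swap_apply_def]
  rw [Fin.lt_def] at hij ⊢
  split_ifs with h1 h2 h2 h3 h2 h3 h4 <;> simp only [Fin.ext_iff] at * <;> omega

theorem adjSwap_adjSwap (k : Fin (n - 1)) (i : Fin n) : adjSwap k (adjSwap k i) = i :=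
  Equiv.swap_apply_self _ _ _

theorem adjSwap_mul_self (k : Fin (n - 1)) : adjSwap k * adjSwap k = 1 := Equiv.swap_mul_self _ _

/-- An adjacent transposition keeps the order of every pair of positions except its own, so applying
it to both positions matches all the other ascending pairs. -/
theorem card_ascendingPairs_mul {k : Fin (n - 1)} {ν : Equiv.Perm (Fin n)}
    (h : ν (leftPos k) < ν (rightPos k)) :
    (ascendingPairs ν).card = (ascendingPairs (ν * adjSwap k)).card + 1 := by
  have hlr : leftPos k < rightPos k := Nat.lt_succ_self _
  have hmem : (leftPos k, rightPos k) ∈ ascendingPairs ν := by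
    simp [ascendingPairs, hlr, h]
  rw [← Finset.card_erase_add_one hmem]
  congr 1
  have hl : adjSwap k (leftPos k) = rightPos k := Equiv.swap_apply_left _ _
  have hr : adjSwap k (rightPos k) = leftPos k := Equiv.swap_apply_right _ _
  refine Finset.card_nbij' (fun p => (adjSwap k p.1, adjSwap k p.2))
    (fun p => (adjSwap k p.1, adjSwap k p.2)) ?_ ?_ ?_ ?_
  · rintro ⟨i, j⟩ hp
    rw [Finset.mem_coe, Finset.mem_erase, mem_ascendingPairs] at hp
    rw [Finset.mem_coe, mem_ascendingPairs, Equiv.Perm.mul_apply, Equiv.Perm.mul_apply,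
      adjSwap_adjSwap, adjSwap_adjSwap]
    exact ⟨adjSwap_lt hp.2.1 hp.1, hp.2.2⟩
  · rintro ⟨i, j⟩ hp
    rw [Finset.mem_coe, mem_ascendingPairs, Equiv.Perm.mul_apply, Equiv.Perm.mul_apply] at hp
    have hne : (i, j) ≠ (leftPos k, rightPos k) := by
      intro hij
      rw [Prod.mk.injEq] at hij
      rw [hij.1, hij.2, hl, hr] at hp
      exact lt_asymm hp.2 h
    rw [Finset.mem_coe, Finset.mem_erase, mem_ascendingPairs]
    refine ⟨fun hij => ?_, adjSwap_lt hp.1 hne, hp.2⟩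
    rw [Prod.mk.injEq] at hij
    have h1 : i = rightPos k := by rw [← adjSwap_adjSwap k i, hij.1, hl]
    have h2 : j = leftPos k := by rw [← adjSwap_adjSwap k j, hij.2, hr]
    rw [h1, h2] at hp
    exact lt_asymm hp.1 hlr
  · rintro ⟨i, j⟩ _
    simp [adjSwap_adjSwap]
  · rintro ⟨i, j⟩ _
    simp [adjSwap_adjSwap]

theorem card_ascendingPairs_mul_of_not_lt {k : Fin (n - 1)} {ν : Equiv.Perm (Fin n)}
    (h : ¬ ν (leftPos k) < ν (rightPos k)) :
    (ascendingPairs (ν * adjSwap k)).card = (ascendingPairs ν).card + 1 := by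
  have h' : (ν * adjSwap k) (leftPos k) < (ν * adjSwap k) (rightPos k) := by
    rw [Equiv.Perm.mul_apply, Equiv.Perm.mul_apply, adjSwap, Equiv.swap_apply_left,
      Equiv.swap_apply_right]
    refine lt_of_le_of_ne (not_lt.1 h) fun h' => ?_
    have := congrArg Fin.val (ν.injective h')
    simp [leftPos, rightPos] at this
  rw [card_ascendingPairs_mul h', mul_assoc, adjSwap_mul_self, mul_one]

theorem card_ascendingPairs_swapAttempt (k : Fin (n - 1)) (ν : Equiv.Perm (Fin n))
    (h : swapAttempt k ν ≠ ν) :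
    (ascendingPairs (swapAttempt k ν)).card < (ascendingPairs ν).card := by
  rw [swapAttempt_of_ne h, card_ascendingPairs_mul ((swapAttempt_ne_iff k ν).1 h)]
  exact Nat.lt_succ_self _

/-- Each swap removes at most one ascending pair. -/
theorem card_ascendingPairs_le (ν : Equiv.Perm (Fin n)) (w : List (Fin (n - 1))) :
    (ascendingPairs ν).card ≤
      w.length + (ascendingPairs (ν * (w.map adjSwap).prod)).card := by
  induction w generalizing ν with
  | nil => simp
  | cons k w ih =>
    have := ih (ν * adjSwap k)
    rw [List.map_cons, List.prod_cons, List.length_cons, ← mul_assoc]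
    by_cases h : ν (leftPos k) < ν (rightPos k)
    · have := card_ascendingPairs_mul h
      omega
    · have := card_ascendingPairs_mul_of_not_lt h
      omega

theorem ascendingPairs_revPerm : ascendingPairs (Fin.revPerm : Equiv.Perm (Fin n)) = ∅ := by
  refine Finset.filter_false_of_mem fun p _ h => ?_
  rw [Fin.revPerm_apply, Fin.revPerm_apply, Fin.rev_lt_rev] at h
  exact lt_asymm h.1 h.2

theorem card_ascendingPairs_one :
    (ascendingPairs (1 : Equiv.Perm (Fin n))).card = n * (n - 1) / 2 := by
  have : ascendingPairs (1 : Equiv.Perm (Fin n)) =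
      Finset.univ.filter fun p : Fin n × Fin n => p.1 < p.2 := by
    simp [ascendingPairs]
  rw [this, Finset.card_filter, Fintype.sum_prod_type_right, ← Finset.sum_range_id,
    ← Fin.sum_univ_eq_sum_range]
  refine Finset.sum_congr rfl fun j _ => ?_
  rw [← Finset.card_filter]
  have : (Finset.univ.filter fun i : Fin n => i < j) = Finset.Iio j := by ext; simp
  rw [this, Fin.card_Iio]

theorem absorbing_swapAttempt_iff (ν : Equiv.Perm (Fin n)) :
    (∀ k, swapAttempt k ν = ν) ↔ ν = Fin.revPerm := by
  have h0 : (∀ k, swapAttempt k ν = ν) ↔ ∀ k, ¬ ν (leftPos k) < ν (rightPos k) :=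
    forall_congr' fun k => by rw [← swapAttempt_ne_iff, not_not]
  rw [h0]
  constructor
  · intro h
    have hanti : StrictAnti ν := by
      cases n with
      | zero => exact fun i => i.elim0
      | succ n =>
        refine Fin.strictAnti_iff_succ_lt.2 fun i => ?_
        refine lt_of_le_of_ne (not_lt.1 (h i)) fun h' => ?_
        have := congrArg Fin.val (ν.injective h')
        simp at this
    refine perm_eq_of_lt_iff fun j k => ?_
    rw [Fin.revPerm_apply, Fin.revPerm_apply, Fin.rev_lt_rev]
    exact hanti.lt_iff_gt
  · rintro rfl k
    rw [Fin.revPerm_apply, Fin.revPerm_apply, Fin.rev_lt_rev]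
    exact (Nat.lt_succ_self _).not_gt

/-- This is the least length allowed by `card_ascendingPairs_le` for reaching the reversal, so no
swap can be ineffective; conversely every successful swap lowers the count by exactly one. -/
theorem complete_swapAttempt_iff (ν : Equiv.Perm (Fin n)) (w : List (Fin (n - 1))) :
    Complete swapAttempt ν w ↔
      w.length = (ascendingPairs ν).card ∧ ν * (w.map adjSwap).prod = Fin.revPerm := by
  induction w generalizing ν with
  | nil =>
    rw [Complete, absorbing_swapAttempt_iff]
    simp only [List.length_nil, List.map_nil, List.prod_nil, mul_one]
    refine ⟨fun h => ⟨?_, h⟩, fun h => h.2⟩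
    rw [h, ascendingPairs_revPerm, Finset.card_empty]
  | cons k w ih =>
    rw [Complete, ih, List.map_cons, List.prod_cons, List.length_cons, ← mul_assoc]
    by_cases h : ν (leftPos k) < ν (rightPos k)
    · have h' := (swapAttempt_ne_iff k ν).2 h
      rw [swapAttempt_of_ne h', card_ascendingPairs_mul h]
      have h2 : ν * adjSwap k ≠ ν := swapAttempt_of_ne h' ▸ h'
      simp [h2]
    · refine iff_of_false (fun h' => h ((swapAttempt_ne_iff k ν).1 h'.1)) ?_
      rintro ⟨h1, h2⟩
      have h3 := card_ascendingPairs_le (ν * adjSwap k) w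
      rw [h2, ascendingPairs_revPerm, Finset.card_empty,
        card_ascendingPairs_mul_of_not_lt h] at h3
      omega

/-- The list of the swaps of a sorting network. -/
def SortingNetwork.word (s : SortingNetwork n) : List (Fin (n - 1)) := List.ofFn s.1

theorem enumerates_word : Enumerates swapAttempt 1 (SortingNetwork.word (n := n)) where
  injective := fun s s' h => Subtype.ext (List.ofFn_injective h)
  complete_iff := fun w => by
    rw [complete_swapAttempt_iff, card_ascendingPairs_one, one_mul]
    constructor
    · rintro ⟨h1, h2⟩
      obtain ⟨s, hs⟩ := exists_ofFn_eq h1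
      refine ⟨⟨s, ?_⟩, hs⟩
      rw [arrangement, hs, List.take_of_length_le h1.le, h2]
    · rintro ⟨s, rfl⟩
      have h := s.2
      rw [arrangement, List.take_of_length_le (List.length_ofFn).le] at h
      exact ⟨List.length_ofFn, h⟩

theorem SortingNetwork.complete (s : SortingNetwork n) : Complete swapAttempt 1 s.word :=
  (enumerates_word.complete_iff _).2 ⟨s, rfl⟩

theorem Complete.foldl_swapAttempt {ν : Equiv.Perm (Fin n)} {w : List (Fin (n - 1))}
    (hw : Complete swapAttempt ν w) (j : ℕ) :
    (w.take j).foldl (fun y k => swapAttempt k y) ν = ν * ((w.take j).map adjSwap).prod := by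
  induction w generalizing ν j with
  | nil => simp
  | cons k w ih =>
    cases j with
    | zero => simp
    | succ j =>
      rw [List.take_succ_cons, List.foldl_cons, ih hw.2, List.map_cons, List.prod_cons,
        swapAttempt_of_ne hw.1, mul_assoc]

theorem SortingNetwork.deg_eq (s : SortingNetwork n) : s.deg = fun j =>
    outDegree swapAttempt ((s.word.take j).foldl (fun y k => swapAttempt k y) 1) := by
  funext j
  rw [s.complete.foldl_swapAttempt, one_mul]
  unfold outDegree SortingNetwork.deg
  congr 1
  ext k
  simp only [Finset.mem_filter, Finset.mem_univ, true_and, swapAttempt_ne_iff]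
  rfl

theorem SortingNetwork.last_eq (s : SortingNetwork n) : s.last = fun k => lastIdx s.word k := by
  funext k
  refine eq_of_forall_lt_iff fun j => ?_
  rw [SortingNetwork.word, lt_lastIdx_ofFn_iff, SortingNetwork.last, Finset.lt_sup_iff]
  simp only [Finset.mem_filter, Finset.mem_univ, true_and, Nat.lt_succ_iff]
  exact exists_congr fun i => and_comm

/-- Without the swap `k`, nothing crosses from positions up to `k` to later ones. The reversal sends
position `0` to `n - 1 > k`, so every swap occurs in a sorting network. -/
theorem prod_adjSwap_le {w : List (Fin (n - 1))} {k : Fin (n - 1)} (hk : k ∉ w) {i : Fin n}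
    (hi : (i : ℕ) ≤ k) : ((w.map adjSwap).prod i : ℕ) ≤ k := by
  induction w with
  | nil => simpa using hi
  | cons l w ih =>
    rw [List.mem_cons, not_or] at hk
    have h := ih hk.2
    have hlk : (k : ℕ) ≠ l := fun h => hk.1 (Fin.ext h)
    rw [List.map_cons, List.prod_cons, Equiv.Perm.mul_apply, adjSwap, Equiv.swap_apply_def]
    split_ifs with h1 h2
    · rw [h1] at h
      have hl : (leftPos l : ℕ) = l := rfl
      have hr : (rightPos l : ℕ) = l + 1 := rfl
      omega
    · rw [h2] at h
      have hl : (leftPos l : ℕ) = l := rfl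
      have hr : (rightPos l : ℕ) = l + 1 := rfl
      omega
    · exact h

theorem SortingNetwork.mem_word (s : SortingNetwork n) (k : Fin (n - 1)) : k ∈ s.word := by
  by_contra hk
  have h := ((complete_swapAttempt_iff _ _).1 s.complete).2
  have hkn := k.isLt
  have h1 := prod_adjSwap_le hk (i := ⟨0, by omega⟩) (Nat.zero_le _)
  rw [one_mul] at h
  rw [h, Fin.revPerm_apply, Fin.val_rev] at h1
  simp only at h1
  omega

theorem SortingNetwork.last_injective (s : SortingNetwork n) :
    Function.Injective fun k => lastIdx s.word k :=
  fun k _ h => eq_of_lastIdx_eq (s.mem_word k) h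

theorem SortingNetwork.length_word (s : SortingNetwork n) : s.word.length = n * (n - 1) / 2 :=
  List.length_ofFn

theorem SortingNetwork.exists_last (hn : 2 ≤ n) (s : SortingNetwork n) :
    ∃ k, lastIdx s.word k = n * (n - 1) / 2 := by
  have hN : 0 < n * (n - 1) / 2 := by
    have : 2 * 1 ≤ n * (n - 1) := Nat.mul_le_mul hn (by omega)
    omega
  exact ⟨_, lastIdx_ofFn_last s.1 (i := ⟨n * (n - 1) / 2 - 1, by omega⟩) (Nat.sub_add_cancel hN)⟩

end Networks

/-! ## Standard Young tableaux as complete words -/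

section Tableaux

variable {n : ℕ}

theorem mem_staircase {c : ℕ × ℕ} : c ∈ (staircase n).cells ↔ c.1 + c.2 + 2 ≤ n := by
  simp only [staircase, Finset.mem_filter, Finset.mem_product, Finset.mem_range]
  omega

theorem addAttempt_ne_iff (b : Box n) (lam : YoungDiagram) :
    addAttempt b lam ≠ lam ↔ b.1 ∉ lam.cells ∧
      IsLowerSet ((insert b.1 lam.cells : Finset (ℕ × ℕ)) : Set (ℕ × ℕ)) := by
  unfold addAttempt
  split_ifs with h
  · rw [Ne, YoungDiagram.ext_iff, Finset.insert_eq_self]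
    exact ⟨fun h' => ⟨h', h⟩, fun h' => h'.1⟩
  · exact iff_of_false (fun h' => h' rfl) fun h' => h h'.2

theorem cells_addAttempt_of_ne {b : Box n} {lam : YoungDiagram} (h : addAttempt b lam ≠ lam) :
    (addAttempt b lam).cells = insert b.1 lam.cells := by
  rw [addAttempt, dif_pos ((addAttempt_ne_iff b lam).1 h).2]

theorem card_sdiff_addAttempt (b : Box n) (lam : YoungDiagram) (h : addAttempt b lam ≠ lam) :
    ((staircase n).cells \ (addAttempt b lam).cells).card <
      ((staircase n).cells \ lam.cells).card := by
  rw [cells_addAttempt_of_ne h]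
  refine Finset.card_lt_card (Finset.ssubset_iff_subset_ne.2 ⟨?_, fun heq => ?_⟩)
  · exact Finset.sdiff_subset_sdiff le_rfl (Finset.subset_insert _ _)
  · have h1 : b.1 ∈ (staircase n).cells \ lam.cells :=
      Finset.mem_sdiff.2 ⟨b.2, ((addAttempt_ne_iff b lam).1 h).1⟩
    rw [← heq] at h1
    exact (Finset.mem_sdiff.1 h1).2 (Finset.mem_insert_self _ _)

/-- A minimal missing box of the staircase has all its predecessors in the diagram, so it could be
added. -/
theorem mem_of_absorbing {lam : YoungDiagram} (h : ∀ b : Box n, addAttempt b lam = lam)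
    (b : Box n) : b.1 ∈ lam.cells := by
  by_contra hb
  have hne : ((staircase n).cells \ lam.cells).Nonempty := ⟨b.1, Finset.mem_sdiff.2 ⟨b.2, hb⟩⟩
  obtain ⟨c, hc⟩ := Finset.exists_minimal hne
  obtain ⟨hcs, hcl⟩ := Finset.mem_sdiff.1 hc.1
  refine (addAttempt_ne_iff ⟨c, hcs⟩ lam).2 ⟨hcl, ?_⟩ (h _)
  intro p q hqp hp
  rw [Finset.mem_coe, Finset.mem_insert] at hp ⊢
  rcases hp with rfl | hp
  · by_cases hq : q ∈ lam.cells
    · exact Or.inr hq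
    · left
      have hqs : q ∈ (staircase n).cells := (staircase n).isLowerSet hqp hcs
      exact le_antisymm hqp (hc.2 (Finset.mem_sdiff.2 ⟨hqs, hq⟩) hqp)
  · exact Or.inr (lam.isLowerSet hqp hp)

theorem Complete.mem_foldl_addAttempt {lam : YoungDiagram} {w : List (Box n)}
    (hw : Complete addAttempt lam w) (j : ℕ) (p : ℕ × ℕ) :
    p ∈ ((w.take j).foldl (fun y b => addAttempt b y) lam).cells ↔
      p ∈ lam.cells ∨ ∃ b ∈ w.take j, b.1 = p := by
  induction w generalizing lam j with
  | nil => simp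
  | cons b w ih =>
    cases j with
    | zero => simp
    | succ j =>
      rw [List.take_succ_cons, List.foldl_cons, ih hw.2, cells_addAttempt_of_ne hw.1,
        Finset.mem_insert]
      simp only [List.mem_cons, exists_eq_or_imp, eq_comm (a := p) (b := b.1)]
      tauto

theorem Complete.nodup {lam : YoungDiagram} {w : List (Box n)}
    (hw : Complete addAttempt lam w) : w.Nodup ∧ ∀ b ∈ w, b.1 ∉ lam.cells := by
  induction w generalizing lam with
  | nil => simp
  | cons b w ih =>
    obtain ⟨h1, h2⟩ := ih hw.2
    rw [cells_addAttempt_of_ne hw.1] at h2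
    refine ⟨List.nodup_cons.2 ⟨fun hb => h2 b hb (Finset.mem_insert_self _ _), h1⟩, ?_⟩
    intro c hc
    rcases List.mem_cons.1 hc with rfl | hc
    · exact ((addAttempt_ne_iff c lam).1 hw.1).1
    · exact fun h => h2 c hc (Finset.mem_insert_of_mem h)

theorem Complete.mem_or_mem {lam : YoungDiagram} {w : List (Box n)}
    (hw : Complete addAttempt lam w) (b : Box n) : b.1 ∈ lam.cells ∨ b ∈ w := by
  induction w generalizing lam with
  | nil => exact Or.inl (mem_of_absorbing hw b)
  | cons c w ih =>
    have := ih hw.2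
    rw [cells_addAttempt_of_ne hw.1, Finset.mem_insert] at this
    rw [List.mem_cons]
    rcases this with (h | h) | h
    · exact Or.inr (Or.inl (Subtype.ext h))
    · exact Or.inl h
    · exact Or.inr (Or.inr h)

/-- `hlow` at `1` makes the first addition succeed, and at `j + 1` it is the hypothesis for the
tail. -/
theorem complete_addAttempt {lam : YoungDiagram} {w : List (Box n)} (hnd : w.Nodup)
    (hdisj : ∀ b ∈ w, b.1 ∉ lam.cells) (hall : ∀ b : Box n, b.1 ∈ lam.cells ∨ b ∈ w)
    (hlow : ∀ j, IsLowerSet {p | p ∈ lam.cells ∨ ∃ b ∈ w.take j, b.1 = p}) :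
    Complete addAttempt lam w := by
  induction w generalizing lam with
  | nil =>
    intro b
    by_contra hb
    exact ((addAttempt_ne_iff b lam).1 hb).1 ((hall b).resolve_right List.not_mem_nil)
  | cons b w ih =>
    have hb : addAttempt b lam ≠ lam := by
      refine (addAttempt_ne_iff b lam).2 ⟨hdisj b List.mem_cons_self, ?_⟩
      convert! hlow 1 using 1
      ext p
      simp [or_comm, eq_comm]
    have hc := cells_addAttempt_of_ne hb
    rw [List.nodup_cons] at hnd
    refine ⟨hb, ih hnd.2 ?_ ?_ ?_⟩
    · intro c hcw h
      rw [hc, Finset.mem_insert] at h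
      rcases h with h | h
      · exact hnd.1 (Subtype.ext h ▸ hcw)
      · exact hdisj c (List.mem_cons_of_mem _ hcw) h
    · intro c
      rw [hc, Finset.mem_insert]
      rcases hall c with h | h
      · exact Or.inl (Or.inr h)
      · rcases List.mem_cons.1 h with rfl | h
        · exact Or.inl (Or.inl rfl)
        · exact Or.inr h
    · intro j
      convert! hlow (j + 1) using 1
      ext p
      simp only [Set.mem_ofPred_eq, hc, Finset.mem_insert, List.take_succ_cons, List.mem_cons,
        exists_eq_or_imp, eq_comm (a := p) (b := b.1)]
      tauto

namespace StaircaseSYT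

variable (t : StaircaseSYT n)

/-- The list of the boxes, in the order of their entries. -/
def word : List (Box n) := List.ofFn t.1.symm

/-- Compare through the box in the row of `b` and the column of `c`, which lies in the staircase
because it is componentwise at most `c`. -/
theorem lt_of_le {b c : Box n} (h : b.1 ≤ c.1) (hne : b ≠ c) : t.1 b < t.1 c := by
  have hd : b.1.1 + c.1.2 + 2 ≤ n → t.1 b < t.1 c := by
    intro hd
    let d : Box n := ⟨(b.1.1, c.1.2), mem_staircase.2 hd⟩
    have h1 : b = d ∨ t.1 b < t.1 d := by
      rcases h.2.eq_or_lt with h' | h'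
      · exact Or.inl (Subtype.ext (Prod.ext rfl h'))
      · exact Or.inr (t.2.1 b d rfl h')
    have h2 : d = c ∨ t.1 d < t.1 c := by
      rcases h.1.eq_or_lt with h' | h'
      · exact Or.inl (Subtype.ext (Prod.ext h' rfl))
      · exact Or.inr (t.2.2 d c rfl h')
    rcases h1 with h1 | h1 <;> rcases h2 with h2 | h2
    · exact absurd (h1.trans h2) hne
    · exact h1 ▸ h2
    · exact h2 ▸ h1
    · exact h1.trans h2
  have hc := mem_staircase.1 c.2
  have := h.1
  exact hd (by omega)

theorem mem_take_word (j : ℕ) (b : Box n) : b ∈ t.word.take j ↔ (t.1 b : ℕ) < j := by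
  rw [word, mem_take_ofFn]
  constructor
  · rintro ⟨i, hi, rfl⟩
    simpa using hi
  · exact fun h => ⟨t.1 b, h, by simp⟩

theorem mem_word (b : Box n) : b ∈ t.word := by
  rw [word, List.mem_ofFn]
  exact ⟨t.1 b, by simp⟩

theorem complete : Complete addAttempt ⊥ t.word := by
  refine complete_addAttempt ?_ (by simp) (fun b => Or.inr (t.mem_word b)) fun j => ?_
  · exact List.nodup_ofFn.2 t.1.symm.injective
  · rintro p q hqp (hp | ⟨b, hb, rfl⟩)
    · simp at hp
    · right
      have hq : q ∈ (staircase n).cells := (staircase n).isLowerSet hqp b.2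
      refine ⟨⟨q, hq⟩, ?_, rfl⟩
      rw [mem_take_word] at hb ⊢
      by_cases hqb : (⟨q, hq⟩ : Box n) = b
      · rwa [hqb]
      · exact lt_trans (t.lt_of_le (b := ⟨q, hq⟩) hqp hqb) hb

theorem word_injective : Function.Injective (word (n := n)) := by
  intro t t' h
  refine Subtype.ext (Equiv.symm_bijective.injective ?_)
  exact Equiv.coe_fn_injective (List.ofFn_injective h)

theorem exists_word_eq {w : List (Box n)} (hw : Complete addAttempt ⊥ w) :
    ∃ t : StaircaseSYT n, t.word = w := by
  have hmem : ∀ b, b ∈ w := fun b => (hw.mem_or_mem b).resolve_left (by simp)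
  have hnd := hw.nodup.1
  have hcard : w.length = (staircase n).card := by
    have h1 : w.toFinset = Finset.univ := by ext b; simp [hmem]
    rw [← List.toFinset_card_of_nodup hnd, h1, Finset.card_univ, Fintype.card_coe]
  obtain ⟨s, rfl⟩ := exists_ofFn_eq hcard
  have hbij : Function.Bijective s :=
    ⟨List.nodup_ofFn.1 hnd, fun b => by simpa [List.mem_ofFn] using hmem b⟩
  let e : Fin (staircase n).card ≃ Box n := Equiv.ofBijective s hbij
  -- Right after `c` is added the diagram is a lower set containing `c`, hence `b`, so `b` was added
  -- no later.
  have hlt : ∀ b c : Box n, b.1 ≤ c.1 → b ≠ c → e.symm b < e.symm c := by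
    intro b c hbc hne
    have hc : c.1 ∈ (((List.ofFn s).take (e.symm c + 1)).foldl
        (fun y b => addAttempt b y) ⊥).cells := by
      rw [hw.mem_foldl_addAttempt]
      refine Or.inr ⟨c, (mem_take_ofFn _ _ _).2 ⟨e.symm c, Nat.lt_succ_self _, ?_⟩, rfl⟩
      exact e.apply_symm_apply c
    have hb := YoungDiagram.isLowerSet _ hbc hc
    rw [Finset.mem_coe, hw.mem_foldl_addAttempt] at hb
    rcases hb with hb | ⟨b', hb', hbb⟩
    · simp at hb
    · obtain rfl := Subtype.ext hbb
      obtain ⟨i, hi, hib⟩ := (mem_take_ofFn _ _ _).1 hb'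
      have hi' : e.symm b' = i := (Equiv.symm_apply_eq e).2 hib.symm
      refine lt_of_le_of_ne ?_ fun h => hne (e.symm.injective h)
      rw [hi', Fin.le_def]
      omega
  refine ⟨⟨e.symm, fun b c h1 h2 => hlt b c ⟨h1.le, h2.le⟩ ?_,
    fun b c h1 h2 => hlt b c ⟨h2.le, h1.le⟩ ?_⟩, rfl⟩
  all_goals
    rintro rfl
    exact lt_irrefl _ h2

theorem enumerates_word : Enumerates addAttempt ⊥ (word (n := n)) where
  injective := word_injective
  complete_iff := fun w => ⟨exists_word_eq, by rintro ⟨t, rfl⟩; exact t.complete⟩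

theorem cells_foldl (j : ℕ) :
    ((t.word.take j).foldl (fun y b => addAttempt b y) ⊥).cells = t.shape j := by
  ext p
  rw [t.complete.mem_foldl_addAttempt]
  simp only [shape, entry, Finset.mem_image, Finset.mem_filter, Finset.mem_univ, true_and,
    mem_take_word, Nat.succ_le_iff]
  simp

theorem deg_eq : t.deg = fun j =>
    outDegree (addAttempt (n := n)) ((t.word.take j).foldl (fun y b => addAttempt b y) ⊥) := by
  classical
  funext j
  unfold outDegree deg
  refine (Finset.card_bij (fun b _ => b.1) ?_ ?_ ?_).symm
  · intro b hb
    rw [Finset.mem_filter, addAttempt_ne_iff, cells_foldl] at hb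
    exact Finset.mem_filter.2 ⟨b.2, hb.2⟩
  · exact fun b _ c _ h => Subtype.ext h
  · intro c hc
    rw [Finset.mem_filter] at hc
    refine ⟨⟨c, hc.1⟩, ?_, rfl⟩
    rw [Finset.mem_filter, addAttempt_ne_iff, cells_foldl]
    exact ⟨Finset.mem_univ _, hc.2⟩

theorem lastIdx_word (b : Box n) : lastIdx t.word b = t.entry b := by
  refine eq_of_forall_lt_iff fun j => ?_
  rw [word, lt_lastIdx_ofFn_iff, entry, Nat.lt_succ_iff]
  constructor
  · rintro ⟨i, hi, rfl⟩
    simpa using hi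
  · exact fun h => ⟨t.1 b, h, by simp⟩

theorem cor_eq : t.cor = fun k => lastIdx t.word (cornerBox k) := by
  funext k
  rw [lastIdx_word, cor]

theorem cornerBox_injective : Function.Injective (cornerBox (n := n)) := by
  intro k l h
  have := congrArg (fun b : Box n => b.1.2) h
  exact Fin.ext this

theorem cor_injective : Function.Injective fun k => lastIdx t.word (cornerBox k) := by
  intro k l h
  simp only [lastIdx_word, entry] at h
  exact cornerBox_injective (t.1.injective (Fin.ext (by omega)))

theorem length_word : t.word.length = (staircase n).card := List.length_ofFn

/-- The largest entry has no staircase box below it, since that box would hold a larger one; so it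
sits in a corner. -/
theorem exists_cor (hn : 2 ≤ n) :
    ∃ k, lastIdx t.word (cornerBox k) = (staircase n).card := by
  have hN : 0 < (staircase n).card := Finset.card_pos.2 ⟨(0, 0), mem_staircase.2 (by simpa using hn)⟩
  let i : Fin (staircase n).card := ⟨(staircase n).card - 1, by omega⟩
  set b := t.1.symm i with hb
  have hbs := mem_staircase.1 b.2
  have hcorner : n ≤ b.1.1 + b.1.2 + 2 := by
    by_contra hlt
    let c : Box n := ⟨(b.1.1 + 1, b.1.2), mem_staircase.2 (by simp only; omega)⟩
    have h1 : t.1 b < t.1 c := t.2.2 b c rfl (Nat.lt_succ_self _)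
    rw [hb, Equiv.apply_symm_apply, Fin.lt_def] at h1
    have h2 := (t.1 c).isLt
    simp only [i] at h1
    omega
  refine ⟨⟨b.1.2, by omega⟩, ?_⟩
  have hbc : cornerBox ⟨b.1.2, by omega⟩ = b := by
    refine Subtype.ext (Prod.ext ?_ rfl)
    simp only [cornerBox]
    omega
  rw [hbc, hb, word]
  exact lastIdx_ofFn_last _ (Nat.sub_add_cancel hN)

end StaircaseSYT

end Tableaux

end OrientedSwap

end

/-! ### Assembly of the equivalence. -/

theorem mainTheorem4 (n : ℕ) (hn : 2 ≤ n)
    {Ω Ω' : Type*} [MeasurableSpace Ω] [MeasurableSpace Ω']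
    (μ : MeasureTheory.Measure Ω) (μ' : MeasureTheory.Measure Ω')
    (E : Fin (n - 1) → ℕ → Ω → ℝ) (hE : IsPoissonClocks μ E)
    (E' : Box n → ℕ → Ω' → ℝ) (hE' : IsPoissonClocks μ' E') :
    ProbabilityTheory.IdentDistrib
        (fun ω => lastSwapTimes hn fun k m => E k m ω)
        (fun ω => cornerTimes hn fun b m => E' b m ω) μ μ' ↔
      (∑ t : StaircaseSYT n, Finsupp.single t.sigma t.f :
          Equiv.Perm (Fin (n - 1)) →₀ RatFun (n - 1)) =
        ∑ s : SortingNetwork n, Finsupp.single s.perm s.g := by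
  classical
  have : Nonempty (Fin (n - 1)) := ⟨⟨0, by omega⟩⟩
  have : Nonempty (Box n) := ⟨cornerBox ⟨0, by omega⟩⟩
  have := hE.indep.isProbabilityMeasure
  have := hE'.indep.isProbabilityMeasure
  have hU := hE.hasTransform enumerates_word (fun ν => (ascendingPairs ν).card)
    card_ascendingPairs_swapAttempt id
    SortingNetwork.last_injective
  have hV := hE'.hasTransform StaircaseSYT.enumerates_word
    (fun lam => ((staircase n).cells \ lam.cells).card) card_sdiff_addAttempt cornerBox
    StaircaseSYT.cor_injective
  refine (hU.identDistrib_iff hV).trans ?_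
  simp only [wordValue_eq_stepValue, SortingNetwork.length_word, StaircaseSYT.length_word]
  have hiff := sum_single_eq_iff
    (v := fun t : StaircaseSYT n => fun k => lastIdx t.word (cornerBox k))
    (d := StaircaseSYT.deg) (N := (staircase n).card)
    (v' := fun s : SortingNetwork n => fun k => lastIdx s.word k)
    (d' := SortingNetwork.deg) (N' := n * (n - 1) / 2)
    (fun t k => (lastIdx_le_length _ _).trans_eq t.length_word) (fun t => t.exists_cor hn)
    (fun t j hj => by
      rw [t.deg_eq]
      exact t.complete.outDegree_pos _ (hj.trans_eq t.length_word.symm))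
    (fun s k => (lastIdx_le_length _ _).trans_eq s.length_word) (fun s => s.exists_last hn)
    (fun s j hj => by
      rw [s.deg_eq]
      exact s.complete.outDegree_pos _ (hj.trans_eq s.length_word.symm))
  simp only [StaircaseSYT.sigma, StaircaseSYT.f, SortingNetwork.perm, SortingNetwork.g,
    StaircaseSYT.cor_eq, SortingNetwork.last_eq]
  rw [hiff]
  simp only [StaircaseSYT.deg_eq, SortingNetwork.deg_eq, id]
  -- The swap process stands first in the distributional statement, the tableaux first in the
  -- algebraic identity.
  exact forall₂_congr fun σ ξ => eq_comm
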